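/- Let $p$ be a prime and let $P$ be a finite $p$-group. A category on $P$ is a category whose objects are the subgroups of $P$, whose morphisms are injective group homomorphisms (composed as maps), and in which every morphism $\varphi : Q \to R$ is the composition of an isomorphism of the category and an inclusion, that is, the induced map $Q \to \varphi(Q)$ and its inverse are morphisms of the category. A subgroup $Q \le P$ is fully $\mathcal F$-normalized if $|N_P(Q)| \ge |N_P(Q')|$ for every $Q'$ that is $\mathcal F$-isomorphic to $Q$. For a morphism $\varphi$ with domain $Q$, let $N_\varphi$ be the group of all $x \in N_P(Q)$ for which there is $y \in N_P(\varphi(Q))$ with $\varphi(xzx^{-1}) = y\varphi(z)y^{-1}$ for all $z \in Q$. A saturated fusion system on $P$ is a category $\mathcal F$ on $P$ that contains all homomorphisms between subgroups of $P$ induced by conjugation by elements of $P$, such that $\mathrm{Aut}_P(P)$ is a Sylow $p$-subgroup of $\mathrm{Aut}_{\mathcal F}(P)$, and such that every $\mathcal F$-isomorphism $\varphi : Q \to Q'$ with $Q'$ fully $\mathcal F$-normalized extends to a morphism $N_\varphi \to P$ in $\mathcal F$. For $Q \le P$, the normalizer $N_{\mathcal F}(Q)$ is the category on $N_P(Q)$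 whose morphisms are those $\varphi : R_1 \to R_2$ in $\mathcal F$, with $R_1, R_2 \le N_P(Q)$, that extend to a morphism $\tilde\varphi : QR_1 \to QR_2$ in $\mathcal F$ with $\tilde\varphi(Q) = Q$. The centralizer $C_{\mathcal F}(Q)$ is the category on $C_P(Q)$ whose morphisms are those $\varphi : R_1 \to R_2$ in $\mathcal F$, with $R_1, R_2 \le C_P(Q)$, that extend to a morphism $\tilde\varphi : QR_1 \to QR_2$ in $\mathcal F$ with $\tilde\varphi|_Q = \mathrm{id}_Q$. Let $\mho^1(Z(P))$ be the subgroup generated by the $p$-th powers of the elements of the center $Z(P)$, and let $J(P)$ be the Thompson subgroup, generated by the abelian subgroups of $P$ of maximum order. **Theorem.** Let $\mathcal F$ be a saturated fusion system on $P$. Then $$\mathcal F = \langle\, C_{\mathcal F}(\mho^1(Z(P))),\ N_{\mathcal F}(J(P)) \,\rangle,$$ that is, $\mathcal F$ is the smallest category on $P$ that contains all morphisms of $C_{\mathcal F}(\mho^1(Z(P)))$ and of $N_{\mathcal F}(J(P))$. -/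

import Mathlib

namespace FusionSystem

variable {G : Type*} [Group G]

/-!  Throughout, the `p`-group `P` is a subgroup of an ambient group `G`, which only serves to let
all subgroups of `P` live in one type; every group occurs, as the subgroup `⊤` of itself. -/

/-- `ψ : S → T` extends `φ : Q → R`: `Q ≤ S` and `ψ` agrees with `φ` on `Q`. -/
def Extends {Q R S T : Subgroup G} (ψ : S →* T) (φ : Q →* R) : Prop :=
  Q ≤ S ∧ ∀ (x : Q) (y : S), (y : G) = x → (ψ y : G) = φ x

/-- The image `φ(A)`, as a subgroup of the ambient group, of the elements of `A` that lie in the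
domain of `φ : Q → R`. -/
def image {Q R : Subgroup G} (φ : Q →* R) (A : Subgroup G) : Subgroup G :=
  (A.subgroupOf Q).map (R.subtype.comp φ)

/-- `N_P(Q)`. -/
def normalizerIn (P Q : Subgroup G) : Subgroup G := P ⊓ Subgroup.normalizer (Q : Set G)

/-- `C_P(Q)`. -/
def centralizerIn (P Q : Subgroup G) : Subgroup G := P ⊓ Subgroup.centralizer (Q : Set G)

/-- A category on `P`: the objects are the subgroups of `P`, the morphisms are injective group
homomorphisms, and every morphism `φ : Q → R` is the composition of an isomorphism of the category
and an inclusion. (This isomorphism is necessarily the map `e : Q → φ(Q)` induced by `φ`, so the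
condition says that `e` and its inverse belong to the category.) -/
@[ext]
structure CategoryOn (P : Subgroup G) where
  Hom : ∀ Q R : Subgroup G, Set (Q →* R)
  le_of_mem : ∀ {Q R : Subgroup G} {φ : Q →* R}, φ ∈ Hom Q R → Q ≤ P ∧ R ≤ P
  injective : ∀ {Q R : Subgroup G} {φ : Q →* R}, φ ∈ Hom Q R → Function.Injective φ
  id_mem : ∀ {Q : Subgroup G}, Q ≤ P → MonoidHom.id Q ∈ Hom Q Q
  comp_mem : ∀ {Q R S : Subgroup G} {φ : Q →* R} {ψ : R →* S},
    φ ∈ Hom Q R → ψ ∈ Hom R S → ψ.comp φ ∈ Hom Q S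
  iso_mem : ∀ {Q R : Subgroup G} {φ : Q →* R}, φ ∈ Hom Q R →
    ∀ (T : Subgroup G) (e : Q ≃* T), (∀ x : Q, (e x : G) = φ x) →
      e.toMonoidHom ∈ Hom Q T ∧ e.symm.toMonoidHom ∈ Hom T Q

namespace CategoryOn

variable {P : Subgroup G} (F : CategoryOn P)

/-- `e : Q → R` is an isomorphism in the category. -/
def IsIso {Q R : Subgroup G} (e : Q ≃* R) : Prop :=
  e.toMonoidHom ∈ F.Hom Q R ∧ e.symm.toMonoidHom ∈ F.Hom R Q

/-- `Q` is fully normalized: `|N_P(Q')| ≤ |N_P(Q)|` whenever `Q'` is `F`-isomorphic to `Q`. -/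
def FullyNormalized (Q : Subgroup G) : Prop :=
  Q ≤ P ∧ ∀ (Q' : Subgroup G) (e : Q ≃* Q'), F.IsIso e →
    Nat.card (normalizerIn P Q') ≤ Nat.card (normalizerIn P Q)

/-- `Aut_F(Q)`, for `Q ≤ P`. -/
def aut (Q : Subgroup G) (hQ : Q ≤ P) : Subgroup (MulAut Q) where
  carrier := {e | F.IsIso (Q := Q) (R := Q) e}
  one_mem' := ⟨F.id_mem hQ, F.id_mem hQ⟩
  mul_mem' := fun ha hb => ⟨F.comp_mem hb.1 ha.1, F.comp_mem ha.2 hb.2⟩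
  inv_mem' := fun ha => ⟨ha.2, ha.1⟩

end CategoryOn

/-- `N_φ`: the elements `x` of `N_P(Q)` for which there is `y ∈ N_P(φ(Q))` with
`φ (x z x⁻¹) = y φ(z) y⁻¹` for all `z ∈ Q`. -/
def extensionGroup (P : Subgroup G) {Q R : Subgroup G} (φ : Q →* R) : Subgroup G where
  carrier := {x | x ∈ normalizerIn P Q ∧ ∃ y ∈ normalizerIn P (image φ Q),
    ∀ z w : Q, (w : G) = x * z * x⁻¹ → (φ w : G) = y * φ z * y⁻¹}
  one_mem' := by
    refine ⟨one_mem _, 1, one_mem _, fun z w h => ?_⟩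
    have : w = z := Subtype.ext (by simpa using h)
    simp [this]
  mul_mem' := by
    rintro a b ⟨ha, y, hy, hya⟩ ⟨hb, y', hy', hyb⟩
    refine ⟨mul_mem ha hb, y * y', mul_mem hy hy', fun z w h => ?_⟩
    have hz : b * z * b⁻¹ ∈ Q := (Subgroup.mem_normalizer_iff.1 hb.2 z).1 z.2
    rw [hya ⟨_, hz⟩ w (by rw [h]; group), hyb z ⟨_, hz⟩ rfl]
    group
  inv_mem' := by
    rintro a ⟨ha, y, hy, hya⟩
    refine ⟨inv_mem ha, y⁻¹, inv_mem hy, fun z w h => ?_⟩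
    rw [hya w z (by rw [h]; group)]
    group

/-- A saturated fusion system on the finite `p`-group `P`. -/
structure CategoryOn.IsSaturated (p : ℕ) {P : Subgroup G} (F : CategoryOn P) : Prop where
  /-- All homomorphisms induced by conjugation by elements of `P` belong to `F`. -/
  conj_mem : ∀ {Q R : Subgroup G}, Q ≤ P → R ≤ P → ∀ φ : Q →* R, ∀ g ∈ P,
    (∀ x : Q, (φ x : G) = g * x * g⁻¹) → φ ∈ F.Hom Q R
  /-- `Aut_P(P)` is a Sylow `p`-subgroup of `Aut_F(P)`. -/
  sylow : ∃ S : Sylow p (F.aut P le_rfl),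
    (S : Subgroup (F.aut P le_rfl)).map (F.aut P le_rfl).subtype =
      (MulAut.conj : P →* MulAut P).range
  /-- Every isomorphism `φ : Q → Q'` with `Q'` fully normalized extends to `N_φ`. -/
  extension : ∀ {Q Q' : Subgroup G} (φ : Q ≃* Q'), F.IsIso φ → F.FullyNormalized Q' →
    ∃ ψ ∈ F.Hom (extensionGroup P φ.toMonoidHom) P, Extends ψ φ.toMonoidHom

theorem le_of_iso {Q R T : Subgroup G} {φ : Q →* R} (e : Q ≃* T)
    (he : ∀ x : Q, (e x : G) = φ x) : T ≤ R := by
  intro t ht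
  have h1 := he (e.symm ⟨t, ht⟩)
  rw [MulEquiv.apply_symm_apply] at h1
  have h2 : t = φ (e.symm ⟨t, ht⟩) := h1
  rw [h2]
  exact (φ (e.symm ⟨t, ht⟩)).2

/-- The category on `P` generated by a collection `X` of morphisms between subgroups of `P`: the
smallest category on `P` that contains them. -/
def generated (P : Subgroup G) (X : ∀ Q R : Subgroup G, Set (Q →* R)) : CategoryOn P where
  Hom Q R := {φ | Q ≤ P ∧ R ≤ P ∧ Function.Injective φ ∧
    ∀ C : CategoryOn P, (∀ S T : Subgroup G, X S T ⊆ C.Hom S T) → φ ∈ C.Hom Q R}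
  le_of_mem h := ⟨h.1, h.2.1⟩
  injective h := h.2.2.1
  id_mem hQ := ⟨hQ, hQ, fun _ _ h => h, fun C _ => C.id_mem hQ⟩
  comp_mem h h' := ⟨h.1, h'.2.1, h'.2.2.1.comp h.2.2.1,
    fun C hC => C.comp_mem (h.2.2.2 C hC) (h'.2.2.2 C hC)⟩
  iso_mem := by
    intro Q R φ h T e he
    have hT : T ≤ P := (le_of_iso e he).trans h.2.1
    exact ⟨⟨h.1, hT, e.injective, fun C hC => (C.iso_mem (h.2.2.2 C hC) T e he).1⟩,
      ⟨hT, h.1, e.symm.injective, fun C hC => (C.iso_mem (h.2.2.2 C hC) T e he).2⟩⟩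


/-- If an injective `φ : R → S` extends to an injective `ψ : Q R → Q S` with `ψ(Q) = Q`, then the
map onto the image of `φ` extends to an isomorphism `Q R → Q φ(R)`. -/
theorem exists_extension_iso {Q R S T : Subgroup G} {φ : R →* S} {ψ : ↥(Q ⊔ R) →* ↥(Q ⊔ S)}
    (hψ : Function.Injective ψ) (hext : Extends ψ φ) (hQ : image ψ Q = Q)
    (e : R ≃* T) (he : ∀ x : R, (e x : G) = φ x) :
    ∃ f : ↥(Q ⊔ R) ≃* ↥(Q ⊔ T), ∀ x, (f x : G) = ψ x := by
  have hinj : Function.Injective ((Q ⊔ S).subtype.comp ψ) :=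
    (Subgroup.subtype_injective _).comp hψ
  have hR : image ψ R = T := by
    ext t
    simp only [image, Subgroup.mem_map, Subgroup.mem_subgroupOf]
    constructor
    · rintro ⟨x, hx, rfl⟩
      have := hext.2 ⟨x, hx⟩ x rfl
      have h2 := he ⟨x, hx⟩
      change (ψ x : G) ∈ T
      rw [this, ← h2]
      exact (e _).2
    · intro ht
      refine ⟨⟨e.symm ⟨t, ht⟩, hext.1 (e.symm ⟨t, ht⟩).2⟩, (e.symm ⟨t, ht⟩).2, ?_⟩
      change (ψ _ : G) = t
      rw [hext.2 (e.symm ⟨t, ht⟩) _ rfl, ← he, MulEquiv.apply_symm_apply]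
  have hrange : ((Q ⊔ S).subtype.comp ψ).range = Q ⊔ T := by
    rw [MonoidHom.range_eq_map, ← Subgroup.subgroupOf_self,
      Subgroup.subgroupOf_sup le_sup_left le_sup_right, Subgroup.map_sup]
    exact congrArg₂ (· ⊔ ·) hQ hR
  exact ⟨(MonoidHom.ofInjective hinj).trans (MulEquiv.subgroupCongr hrange), fun x => rfl⟩

theorem mem_image {Q R : Subgroup G} {φ : Q →* R} {A : Subgroup G} {t : G} :
    t ∈ image φ A ↔ ∃ x : Q, (x : G) ∈ A ∧ (φ x : G) = t := Iff.rfl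

theorem Extends.refl {Q S : Subgroup G} (h : Q ≤ S) :
    Extends (MonoidHom.id S) (MonoidHom.id Q) := ⟨h, fun _ _ h => h⟩

theorem Extends.comp {Q R U S T V : Subgroup G} {ψ : S →* T} {φ : Q →* R} {ψ' : T →* V}
    {φ' : R →* U} (h' : Extends ψ' φ') (h : Extends ψ φ) :
    Extends (ψ'.comp ψ) (φ'.comp φ) :=
  ⟨h.1, fun x y hxy => h'.2 (φ x) (ψ y) (h.2 x y hxy)⟩

theorem Extends.iso {R S T A B C : Subgroup G} {φ : R →* S} {ψ : A →* B} (h : Extends ψ φ)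
    (hTC : T ≤ C) (e : R ≃* T) (he : ∀ x : R, (e x : G) = φ x)
    (f : A ≃* C) (hf : ∀ x, (f x : G) = ψ x) :
    Extends f.toMonoidHom e.toMonoidHom ∧ Extends f.symm.toMonoidHom e.symm.toMonoidHom := by
  have h1 : ∀ (x : R) (y : A), (y : G) = x → (f y : G) = e x := fun x y hxy => by
    rw [hf, he]; exact h.2 x y hxy
  refine ⟨⟨h.1, h1⟩, hTC, fun x y hxy => ?_⟩
  have h2 := h1 (e.symm x) ⟨e.symm x, h.1 (e.symm x).2⟩ rfl
  rw [MulEquiv.apply_symm_apply, ← hxy] at h2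
  have h3 : f ⟨e.symm x, h.1 (e.symm x).2⟩ = y := Subtype.ext h2
  change ((f.symm y : A) : G) = (e.symm x : G)
  rw [← h3, MulEquiv.symm_apply_apply]

theorem image_iso {A B C Q : Subgroup G} {ψ : A →* B} (hQA : Q ≤ A) (h : image ψ Q = Q)
    (f : A ≃* C) (hf : ∀ x, (f x : G) = ψ x) :
    image f.toMonoidHom Q = Q ∧ image f.symm.toMonoidHom Q = Q := by
  have h1 : image f.toMonoidHom Q = Q := by
    rw [← h]
    ext t
    rw [mem_image, h, ← h, mem_image]
    constructor <;> rintro ⟨x, hx, rfl⟩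
    · exact ⟨x, by rwa [h] at hx, (hf x).symm⟩
    · exact ⟨x, by rwa [h], hf x⟩
  refine ⟨h1, ?_⟩
  ext t
  rw [mem_image]
  constructor
  · rintro ⟨x, hx, rfl⟩
    rw [← h1, mem_image] at hx
    obtain ⟨y, hy, hyx⟩ := hx
    have : f y = x := Subtype.ext hyx
    change (f.symm x : G) ∈ Q
    rwa [← this, MulEquiv.symm_apply_apply]
  · intro ht
    refine ⟨f ⟨t, hQA ht⟩, ?_, ?_⟩
    · have : (f ⟨t, hQA ht⟩ : G) ∈ image f.toMonoidHom Q := ⟨⟨t, hQA ht⟩, ht, rfl⟩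
      rwa [h1] at this
    · change (f.symm (f ⟨t, hQA ht⟩) : G) = t
      rw [MulEquiv.symm_apply_apply]

theorem image_comp {A B C Q : Subgroup G} {ψ' : B →* C} {ψ : A →* B} (h' : image ψ' Q = Q)
    (h : image ψ Q = Q) : image (ψ'.comp ψ) Q = Q := by
  ext t
  rw [mem_image]
  constructor
  · rintro ⟨x, hx, rfl⟩
    have h4 : (ψ x : G) ∈ image ψ Q := ⟨x, hx, rfl⟩
    rw [h] at h4
    have h5 : (ψ' (ψ x) : G) ∈ image ψ' Q := ⟨ψ x, h4, rfl⟩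
    rwa [h'] at h5
  · intro ht
    rw [← h', mem_image] at ht
    obtain ⟨y, hy, rfl⟩ := ht
    rw [← h, mem_image] at hy
    obtain ⟨x, hx, hxy⟩ := hy
    have h4 : ψ x = y := Subtype.ext hxy
    exact ⟨x, hx, by rw [← h4]; rfl⟩

theorem image_eq_of_id {A B Q : Subgroup G} {ψ : A →* B} (hQA : Q ≤ A)
    (h : ∀ x : A, (x : G) ∈ Q → (ψ x : G) = x) : image ψ Q = Q := by
  ext t
  rw [mem_image]
  constructor
  · rintro ⟨x, hx, rfl⟩
    rwa [h x hx]
  · exact fun ht => ⟨⟨t, hQA ht⟩, ht, h ⟨t, hQA ht⟩ ht⟩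

variable {P : Subgroup G}

/-- `N_F(Q)`, the normalizer of `Q` in `F`. It is a category on `N_P(Q)`; its morphisms are the
`φ : R₁ → R₂` in `F` with an extension `ψ : Q R₁ → Q R₂` in `F` such that `ψ(Q) = Q`. -/
def CategoryOn.normalizer (F : CategoryOn P) (Q : Subgroup G) (hQ : Q ≤ P) :
    CategoryOn (normalizerIn P Q) where
  Hom R₁ R₂ := {φ | R₁ ≤ normalizerIn P Q ∧ R₂ ≤ normalizerIn P Q ∧ φ ∈ F.Hom R₁ R₂ ∧
    ∃ ψ ∈ F.Hom (Q ⊔ R₁) (Q ⊔ R₂), Extends ψ φ ∧ image ψ Q = Q}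
  le_of_mem h := ⟨h.1, h.2.1⟩
  injective h := F.injective h.2.2.1
  id_mem h := ⟨h, h, F.id_mem (h.trans inf_le_left), MonoidHom.id _,
    F.id_mem (sup_le hQ (h.trans inf_le_left)), Extends.refl le_sup_right, image_eq_of_id le_sup_left fun _ _ => rfl⟩
  comp_mem := by
    rintro R S T φ φ' ⟨h1, _, h3, ψ, hψ, hext, him⟩ ⟨_, h2', h3', ψ', hψ', hext', him'⟩
    refine ⟨h1, h2', F.comp_mem h3 h3', ψ'.comp ψ, F.comp_mem hψ hψ', hext'.comp hext,
      image_comp him' him⟩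
  iso_mem := by
    rintro R S φ ⟨h1, h2, h3, ψ, hψ, hext, him⟩ T e he
    obtain ⟨f, hf⟩ := exists_extension_iso (F.injective hψ) hext him e he
    have hT := (le_of_iso e he).trans h2
    have hE := hext.iso le_sup_right e he f hf
    have hI := image_iso le_sup_left him f hf
    have hF := F.iso_mem h3 T e he
    have hF' := F.iso_mem hψ _ f hf
    exact ⟨⟨h1, hT, hF.1, _, hF'.1, hE.1, hI.1⟩, hT, h1, hF.2, _, hF'.2, hE.2, hI.2⟩

/-- `C_F(Q)`, the centralizer of `Q` in `F`. It is a category on `C_P(Q)`; its morphisms are the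
`φ : R₁ → R₂` in `F` with an extension `ψ : Q R₁ → Q R₂` in `F` that is the identity on `Q`. -/
def CategoryOn.centralizer (F : CategoryOn P) (Q : Subgroup G) (hQ : Q ≤ P) :
    CategoryOn (centralizerIn P Q) where
  Hom R₁ R₂ := {φ | R₁ ≤ centralizerIn P Q ∧ R₂ ≤ centralizerIn P Q ∧ φ ∈ F.Hom R₁ R₂ ∧
    ∃ ψ ∈ F.Hom (Q ⊔ R₁) (Q ⊔ R₂), Extends ψ φ ∧ ∀ x : ↥(Q ⊔ R₁), (x : G) ∈ Q → (ψ x : G) = x}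
  le_of_mem h := ⟨h.1, h.2.1⟩
  injective h := F.injective h.2.2.1
  id_mem h := ⟨h, h, F.id_mem (h.trans inf_le_left), MonoidHom.id _,
    F.id_mem (sup_le hQ (h.trans inf_le_left)), Extends.refl le_sup_right, fun _ _ => rfl⟩
  comp_mem := by
    rintro R S T φ φ' ⟨h1, _, h3, ψ, hψ, hext, hid⟩ ⟨_, h2', h3', ψ', hψ', hext', hid'⟩
    refine ⟨h1, h2', F.comp_mem h3 h3', ψ'.comp ψ, F.comp_mem hψ hψ', hext'.comp hext, ?_⟩
    intro x hx
    exact (hid' (ψ x) (by rwa [hid x hx])).trans (hid x hx)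
  iso_mem := by
    rintro R S φ ⟨h1, h2, h3, ψ, hψ, hext, hid⟩ T e he
    obtain ⟨f, hf⟩ := exists_extension_iso (F.injective hψ) hext
      (image_eq_of_id le_sup_left hid) e he
    have hT := (le_of_iso e he).trans h2
    have hE := hext.iso le_sup_right e he f hf
    have hF := F.iso_mem h3 T e he
    have hF' := F.iso_mem hψ _ f hf
    have hfid : ∀ x : ↥(Q ⊔ R), (x : G) ∈ Q → (f x : G) = x :=
      fun x hx => (hf x).trans (hid x hx)
    refine ⟨⟨h1, hT, hF.1, _, hF'.1, hE.1, hfid⟩, hT, h1, hF.2, _, hF'.2, hE.2, ?_⟩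
    intro x hx
    have h4 : f ⟨x, le_sup_left (a := Q) hx⟩ = x := Subtype.ext (hfid _ hx)
    change (f.symm x : G) = x
    conv_lhs => rw [← h4]
    rw [MulEquiv.symm_apply_apply]

/-- `Z(P)`, as a subgroup of the ambient group. -/
def centerOf (P : Subgroup G) : Subgroup G := (Subgroup.center P).map P.subtype

/-- `℧ⁿ(Q)`, the subgroup generated by the `pⁿ`-th powers of the elements of `Q`. -/
def mho (p n : ℕ) (Q : Subgroup G) : Subgroup G :=
  Subgroup.closure {y | ∃ x ∈ Q, y = x ^ p ^ n}

/-- The Thompson subgroup `J(P)` of a finite group `P`, generated by the abelian subgroups of `P`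
of maximum order. -/
def thompson (P : Subgroup G) : Subgroup G :=
  sSup {A | A ≤ P ∧ IsMulCommutative A ∧
    ∀ B : Subgroup G, B ≤ P → IsMulCommutative B → Nat.card B ≤ Nat.card A}

theorem mho_centerOf_le (p n : ℕ) (P : Subgroup G) : mho p n (centerOf P) ≤ P := by
  refine (Subgroup.closure_le _).2 ?_
  rintro y ⟨x, hx, rfl⟩
  exact pow_mem (Subgroup.map_subtype_le _ hx) _

theorem thompson_le (P : Subgroup G) : thompson P ≤ P :=
  sSup_le fun _ hA => hA.1

end FusionSystem

open FusionSystem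

/-! The induction runs over local systems (`IsLocalSystem`): saturated families `E` of isomorphisms
between the subgroups of a p-group N that contain a fixed normal subgroup X, all mapping X to
itself. A saturated F is the case X = 1 (`IsSaturated.isLocalSystem`). If R is nice, that is, fully
automized and receptive, the members of `E` that normalize R form a local system with R and N_N(R)
in place of X and N (`IsLocalSystem.normFamily`).

Let Z be central in N; in the application Z = Z(P) throughout. The claim (`subset_of_generators`),
by induction on |N| - |X|, is that a family `H` closed under inverses, composition and restriction
contains `E` once it contains the members of `E` that fix the p-th powers of Z and those whose
domain contains J(N). Alperin's theorem reduces such statements to automorphisms of nice subgroups.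

If Z is not in X, automorphisms of X extend to XZ. For nice R > X, the induction leaves the maps in
N_E(R) whose domain contains J(N_N(R)). These normalize X J(N_N(R)), whose normalizer in N is
strictly larger than N_N(R) unless N_N(R) = N, and a second induction applies (`subset_of_not_le`).

If Z ≤ X, let V be generated by the images of Z under Aut_E(X), and W = ℧¹(V); both are invariant
and central in X. If C_N(W) > X, a Frattini argument writes an automorphism as one that fixes W,
hence the p-th powers of Z, times one that extends to a larger subgroup (`subset_of_centralizer`).
If C_N(W) = X, then J(N) ≤ X, so every domain contains J(N) (`thompson_le_of_centralizer`). Indeed,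
otherwise Thompson replacement yields an abelian A of maximum order with [V, A] ≠ 1 = [V, A, A], so
that [a^p, v] = [a, v]^p = [a, v^p] for a in A and v in V. An element of N trivial on V/W and on W
centralizes V (`commute_hull`). Descending through the powers of a, this shows that a^p centralizes
V. Then a centralizes W, so a lies in X and centralizes V, a contradiction. -/

namespace FusionSystem

/-! ### Sylow and Frattini arguments in finite groups -/

section GroupTheory

variable {G : Type*} [Group G]

/-- `T` is conjugated into `S` by `β`. -/
def ConjInto (β : G) (T S : Subgroup G) : Prop := ∀ t ∈ T, β * t * β⁻¹ ∈ S

theorem ConjInto.card_le {β : G} {T S : Subgroup G} [Finite S] (h : ConjInto β T S) :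
    Nat.card T ≤ Nat.card S :=
  Nat.card_le_card_of_injective (fun t : T => (⟨β * t * β⁻¹, h t t.2⟩ : S)) fun s t hst => by
    have h1 : β * (s : G) * β⁻¹ = β * t * β⁻¹ := congrArg Subtype.val hst
    exact Subtype.ext (mul_left_cancel (mul_right_cancel h1))

theorem eq_of_le_of_card {S T : Subgroup G} [Finite T] (h : S ≤ T)
    (hc : Nat.card T ≤ Nat.card S) : S = T :=
  Subgroup.eq_of_le_of_card_ge h hc

theorem isMulCommutative_iff {A : Subgroup G} :
    IsMulCommutative A ↔ ∀ x ∈ A, ∀ y ∈ A, x * y = y * x := by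
  constructor
  · intro h x hx y hy
    have := h.is_comm.comm ⟨x, hx⟩ ⟨y, hy⟩
    exact congrArg Subtype.val this
  · intro h
    exact ⟨⟨fun x y => Subtype.ext (h x x.2 y y.2)⟩⟩

theorem exists_normalizing {p : ℕ} [Fact p.Prime] {H K : Subgroup G} [Finite K]
    (hK : IsPGroup p K) (h : H < K) : ∃ k ∈ K, k ∉ H ∧ ∀ x ∈ H, k * x * k⁻¹ ∈ H := by
  have hn : Group.IsNilpotent K := hK.isNilpotent
  have h1 : H.subgroupOf K < ⊤ := by
    rw [lt_top_iff_ne_top, Ne, Subgroup.subgroupOf_eq_top]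
    exact not_le_of_gt h
  obtain ⟨k, hk, hk'⟩ := SetLike.exists_of_lt (Group.normalizerCondition_of_isNilpotent _ h1)
  refine ⟨k, k.2, fun h' => hk' (Subgroup.mem_subgroupOf.2 h'), fun x hx => ?_⟩
  have := (Subgroup.mem_normalizer_iff.1 hk ⟨x, h.le hx⟩).1 (Subgroup.mem_subgroupOf.2 hx)
  simpa [Subgroup.mem_subgroupOf] using this

/-- Sylow's theorem inside a finite subgroup `A`. -/
theorem exists_sylow_of_le {p : ℕ} [Fact p.Prime] {A T : Subgroup G} [Finite A]
    (hT : IsPGroup p T) (hTA : T ≤ A) :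
    ∃ S ≤ A, IsPGroup p S ∧ T ≤ S ∧
      ∀ U : Subgroup G, IsPGroup p U → U ≤ A → ∃ β ∈ A, ConjInto β U S := by
  have hT' : IsPGroup p (T.subgroupOf A) := hT.comap_subtype
  obtain ⟨S, hS⟩ := hT'.exists_le_sylow
  refine ⟨(S : Subgroup A).map A.subtype, Subgroup.map_subtype_le _, S.2.map _, ?_, ?_⟩
  · intro t ht
    exact ⟨⟨t, hTA ht⟩, hS (Subgroup.mem_subgroupOf.2 ht), rfl⟩
  · intro U hU hUA
    have hU' : IsPGroup p (U.subgroupOf A) := hU.comap_subtype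
    obtain ⟨S', hS'⟩ := hU'.exists_le_sylow
    obtain ⟨β, hβ⟩ := MulAction.exists_smul_eq A S' S
    refine ⟨β, β.2, fun u hu => ?_⟩
    have h1 : (⟨u, hUA hu⟩ : A) ∈ S' := hS' (Subgroup.mem_subgroupOf.2 hu)
    refine ⟨β * ⟨u, hUA hu⟩ * β⁻¹, ?_, rfl⟩
    rw [← hβ]
    exact Subgroup.smul_mem_pointwise_smul (⟨u, hUA hu⟩ : A) (MulAut.conj β) _ h1

/-- If `S` contains a conjugate of each `p`-subgroup of `A` and `C` is normalized by `A`, then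
`S ⊓ C` contains a `C`-conjugate of each `p`-subgroup of `C`. -/
theorem exists_conjInto_inf {p : ℕ} [Fact p.Prime] {A S C : Subgroup G} [Finite A]
    (hS : IsPGroup p S) (hCA : C ≤ A)
    (hfull : ∀ T : Subgroup G, IsPGroup p T → T ≤ A → ∃ β ∈ A, ConjInto β T S)
    (hC : ∀ α ∈ A, ConjInto α C C) {U : Subgroup G} (hU : IsPGroup p U) (hUC : U ≤ C) :
    ∃ c ∈ C, ConjInto c U (S ⊓ C) := by
  have : Finite C := Finite.of_injective _ (Subgroup.inclusion_injective hCA)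
  -- A Sylow subgroup `S1` of `C` above `S ⊓ C` is conjugated by `A` into `S`, and stays in `C`;
  -- comparing orders gives `S ⊓ C = S1`.
  obtain ⟨S1, hS1C, hS1, hle, h1⟩ := exists_sylow_of_le (A := C)
    (hS.to_le inf_le_left) (inf_le_right : S ⊓ C ≤ C)
  obtain ⟨β, hβA, hβ⟩ := hfull S1 hS1 (hS1C.trans hCA)
  have : Finite S1 := Finite.of_injective _ (Subgroup.inclusion_injective hS1C)
  have : Finite ↥(S ⊓ C) :=
    Finite.of_injective _ (Subgroup.inclusion_injective (inf_le_right : S ⊓ C ≤ C))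
  have h2 : ConjInto β S1 (S ⊓ C) := fun t ht => ⟨hβ t ht, hC β hβA t (hS1C ht)⟩
  rw [eq_of_le_of_card hle h2.card_le]
  exact h1 U hU hUC

/-- The Frattini argument. -/
theorem exists_mul_conjInto {p : ℕ} [Fact p.Prime] {A S C : Subgroup G} [Finite A]
    (hS : IsPGroup p S) (hCA : C ≤ A)
    (hfull : ∀ T : Subgroup G, IsPGroup p T → T ≤ A → ∃ β ∈ A, ConjInto β T S)
    (hC : ∀ α ∈ A, ConjInto α C C) {α : G} (hα : α ∈ A) :
    ∃ c ∈ C, ConjInto (c * α) (S ⊓ C) (S ⊓ C) := by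
  obtain ⟨c, hc, h⟩ := exists_conjInto_inf hS hCA hfull hC
    (U := (S ⊓ C).map (MulAut.conj α).toMonoidHom) ((hS.to_le inf_le_left).map _) (by
      rintro _ ⟨t, ht, rfl⟩
      exact hC α hα t ht.2)
  refine ⟨c, hc, fun t ht => ?_⟩
  have := h _ ⟨t, ht, rfl⟩
  simpa [mul_assoc] using this

/-- A group is the product of a Sylow subgroup and a normal subgroup with quotient of
exponent `p`. -/
theorem exists_mul_of_pow_mem {p : ℕ} [Fact p.Prime] {A S C D : Subgroup G} [Finite A]
    (hS : IsPGroup p S) (hCA : C ≤ A)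
    (hfull : ∀ T : Subgroup G, IsPGroup p T → T ≤ A → ∃ β ∈ A, ConjInto β T S)
    (hC : ∀ α ∈ A, ConjInto α C C) (hD : ∀ α ∈ C, ConjInto α D D)
    (hpow : ∀ α ∈ C, α ^ p ∈ D) {α : G} (hα : α ∈ C) :
    ∃ s ∈ S ⊓ C, ∃ d ∈ D, α = s * d := by
  have : Finite C := Finite.of_injective _ (Subgroup.inclusion_injective hCA)
  obtain ⟨Q⟩ : Nonempty (Sylow p C) := inferInstance
  obtain ⟨c, hc, hcQ⟩ := exists_conjInto_inf hS hCA hfull hC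
    (U := (Q : Subgroup C).map C.subtype) (Q.2.map _) (Subgroup.map_subtype_le _)
  have : (D.subgroupOf C).Normal := ⟨fun n hn g => hD g g.2 n hn⟩
  have h1 : IsPGroup p (C ⧸ D.subgroupOf C) := by
    intro g
    induction g using QuotientGroup.induction_on with
    | H x =>
      refine ⟨1, ?_⟩
      rw [pow_one, ← QuotientGroup.mk_pow, QuotientGroup.eq_one_iff]
      exact hpow x x.2
  obtain ⟨n, hn⟩ := IsPGroup.iff_card.1 h1
  -- The index of `Q D` in `C` is a power of `p` because `C / D` is a `p`-group, and prime to `p`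
  -- because `Q` is Sylow.
  have h2 : ((Q : Subgroup C) ⊔ D.subgroupOf C).index = 1 := by
    have h3 : ((Q : Subgroup C) ⊔ D.subgroupOf C).index ∣ p ^ n := by
      rw [← hn]; exact Subgroup.index_dvd_of_le le_sup_right
    obtain ⟨k, -, hk⟩ := (Nat.dvd_prime_pow Fact.out).1 h3
    rcases Nat.eq_zero_or_pos k with rfl | hk0
    · simpa using hk
    · exfalso
      refine Q.not_dvd_index ?_
      exact ((dvd_pow_self p hk0.ne').trans hk.symm.dvd).trans
        (Subgroup.index_dvd_of_le le_sup_left)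
  rw [Subgroup.index_eq_one] at h2
  -- Decomposing `c⁻¹ α c` instead of `α` lets conjugation by `c` carry the factor from `Q` into `S
  -- ⊓ C`.
  have h4 : (⟨c⁻¹ * α * c, mul_mem (mul_mem (inv_mem hc) hα) hc⟩ : C) ∈
      (Q : Subgroup C) ⊔ D.subgroupOf C := by rw [h2]; trivial
  obtain ⟨q, hq, d, hd, hqd⟩ := Subgroup.mem_sup_of_normal_right.1 h4
  have h5 : (q : G) * d = c⁻¹ * α * c := congrArg Subtype.val hqd
  refine ⟨c * q * c⁻¹, hcQ q ⟨q, hq, rfl⟩, c * d * c⁻¹, hD c hc d hd, ?_⟩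
  calc α = c * (c⁻¹ * α * c) * c⁻¹ := by group
    _ = _ := by rw [← h5]; group

/-! ### Abelian subgroups of maximum order and Thompson replacement -/

/-- `A` is an abelian subgroup of maximum order of `N`. -/
def IsMaxAbelian (N A : Subgroup G) : Prop :=
  A ≤ N ∧ IsMulCommutative A ∧
    ∀ B : Subgroup G, B ≤ N → IsMulCommutative B → Nat.card B ≤ Nat.card A

theorem IsMaxAbelian.le_thompson {N A : Subgroup G} (h : IsMaxAbelian N A) : A ≤ thompson N :=
  le_sSup h

theorem isMulCommutative_sup {A B : Subgroup G} (hA : IsMulCommutative A)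
    (hB : IsMulCommutative B) (h : ∀ a ∈ A, ∀ b ∈ B, a * b = b * a) :
    IsMulCommutative (A ⊔ B : Subgroup G) := by
  have hAB : B ≤ Subgroup.centralizer A :=
    fun b hb => Subgroup.mem_centralizer_iff.2 fun a ha => h a ha b hb
  rw [← Subgroup.le_centralizer_iff_isMulCommutative] at *
  refine sup_le (Subgroup.le_centralizer_iff.1 (sup_le hA hAB))
    (Subgroup.le_centralizer_iff.1 (sup_le (Subgroup.le_centralizer_iff.1 hAB) hB))

theorem exists_isMaxAbelian (N : Subgroup G) [Finite N] : ∃ A, IsMaxAbelian N A := by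
  have hfin : ((fun A : Subgroup G => Nat.card A) ''
      {A : Subgroup G | A ≤ N ∧ IsMulCommutative A}).Finite := by
    refine (Set.finite_Iic (Nat.card N)).subset ?_
    rintro _ ⟨A, hA, rfl⟩
    exact Subgroup.card_le_of_le hA.1
  obtain ⟨_, ⟨A, hA, rfl⟩, hmax⟩ := hfin.exists_maximal
    ⟨_, ⊥, ⟨bot_le, isMulCommutative_iff.2 (by simp)⟩, rfl⟩
  refine ⟨A, hA.1, hA.2, fun B hB hB' => ?_⟩
  by_contra hlt
  exact hlt (hmax ⟨B, ⟨hB, hB'⟩, rfl⟩ (not_le.1 hlt).le)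

theorem IsMaxAbelian.le_of_commute {N A B : Subgroup G} [Finite N] (h : IsMaxAbelian N A)
    (hB : B ≤ N) (hB' : IsMulCommutative B) (hAB : ∀ a ∈ A, ∀ b ∈ B, a * b = b * a) : B ≤ A := by
  have : Finite ↥(A ⊔ B) :=
    Finite.of_injective _ (Subgroup.inclusion_injective (sup_le h.1 hB))
  have h1 := eq_of_le_of_card (le_sup_left : A ≤ A ⊔ B)
    (h.2.2 _ (sup_le h.1 hB) (isMulCommutative_sup h.2.1 hB' hAB))
  rw [h1]
  exact le_sup_right

theorem IsMaxAbelian.mem_of_commute {N A : Subgroup G} [Finite N] (h : IsMaxAbelian N A)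
    {x : G} (hx : x ∈ N) (hA : ∀ a ∈ A, a * x = x * a) : x ∈ A := by
  refine h.le_of_commute (B := Subgroup.zpowers x) (by simpa using hx) inferInstance ?_
    (Subgroup.mem_zpowers x)
  rintro a ha _ ⟨k, rfl⟩
  exact (Commute.zpow_right (hA a ha) k)

/-- If `M = [A, b]` is abelian, then `M C_A(M)` is again an abelian subgroup of maximum order. -/
theorem IsMaxAbelian.sup_centralizer {N A M : Subgroup G} [Finite N] (h : IsMaxAbelian N A)
    {b : G} (hM : M = Subgroup.closure {y | ∃ a ∈ A, y = a * b * a⁻¹ * b⁻¹}) (hMN : M ≤ N)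
    (hMc : IsMulCommutative M) (hb : ∀ m ∈ M, b * m = m * b) :
    IsMaxAbelian N (M ⊔ (A ⊓ Subgroup.centralizer M)) := by
  have hgen : ∀ a ∈ A, a * b * a⁻¹ * b⁻¹ ∈ M := fun a ha => by
    rw [hM]; exact Subgroup.subset_closure ⟨a, ha, rfl⟩
  set C := A ⊓ Subgroup.centralizer (M : Set G) with hC
  have hAcomm := isMulCommutative_iff.1 h.2.1
  have hMcomm := isMulCommutative_iff.1 hMc
  have hCc : IsMulCommutative C := isMulCommutative_iff.2 fun x hx y hy =>
    hAcomm x hx.1 y hy.1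
  have : Finite A := Finite.of_injective _ (Subgroup.inclusion_injective h.1)
  have : Finite M := Finite.of_injective _ (Subgroup.inclusion_injective hMN)
  have hle : M ⊔ C ≤ N := sup_le hMN (inf_le_left.trans h.1)
  have : Finite ↥(M ⊔ C) := Finite.of_injective _ (Subgroup.inclusion_injective hle)
  refine ⟨hle, isMulCommutative_sup hMc hCc fun m hm c hc =>
    Subgroup.mem_centralizer_iff.1 hc.2 m hm, fun B hB hB' => (h.2.2 B hB hB').trans ?_⟩
  -- The map `a C ↦ [a, b] (A ⊓ M)`, taken on chosen representatives, is injective. Together with `C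
  -- ⊓ M = A ⊓ M` this bounds `|A : C|` by `|M C : C|`.
  have h1 : C.relIndex A ≤ A.relIndex M := by
    refine Nat.card_le_card_of_injective (α := A ⧸ C.subgroupOf A) (β := M ⧸ A.subgroupOf M)
      (fun q => ((⟨q.out * b * (q.out : G)⁻¹ * b⁻¹, hgen _ q.out.2⟩ : M) :
        M ⧸ A.subgroupOf M)) ?_
    intro q q' hqq
    rw [← q.out_eq', ← q'.out_eq']
    have h2 := QuotientGroup.eq.1 hqq
    rw [Subgroup.mem_subgroupOf] at h2
    set u : A := q.out
    set v : A := q'.out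
    refine QuotientGroup.eq.2 ?_
    rw [Subgroup.mem_subgroupOf]
    refine ⟨(u⁻¹ * v).2, Subgroup.mem_centralizer_iff.2 ?_⟩
    have hd : b * ((u : G) * b * (u : G)⁻¹ * b⁻¹)⁻¹ * (v * b * (v : G)⁻¹ * b⁻¹) =
        (u * b * (u : G)⁻¹ * b⁻¹)⁻¹ * (v * b * (v : G)⁻¹ * b⁻¹) * b := by
      rw [mul_assoc]
      exact hb _ (mul_mem (inv_mem (hgen u u.2)) (hgen v v.2))
    set w : G := (u : G)⁻¹ * v with hw
    -- Since `b` commutes with `M`, the quotient `[u, b]⁻¹ [v, b]` is the conjugate by `u` of `b⁻¹ w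
    -- b w⁻¹`; as it lies in `A`, this element commutes with every `a` in `A`.
    have hdw : (u * b * (u : G)⁻¹ * b⁻¹)⁻¹ * (v * b * (v : G)⁻¹ * b⁻¹) =
        u * (b⁻¹ * w * b * w⁻¹) * (u : G)⁻¹ := by
      rw [hw]
      calc _ = b⁻¹ * (b * ((u : G) * b * (u : G)⁻¹ * b⁻¹)⁻¹ * (v * b * (v : G)⁻¹ * b⁻¹)) := by
            group
        _ = b⁻¹ * (b * (u * b⁻¹ * (u : G)⁻¹ * (v * b * (v : G)⁻¹))) := by rw [hd]; group
        _ = _ := by group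
    have h3 : M ≤ Subgroup.centralizer {((u⁻¹ * v : A) : G)} := by
      conv_lhs => rw [hM]
      rw [Subgroup.closure_le]
      rintro _ ⟨a, ha, rfl⟩
      have h4 := hAcomm a ha _ h2
      change a * ((u * b * (u : G)⁻¹ * b⁻¹)⁻¹ * (v * b * (v : G)⁻¹ * b⁻¹)) =
        ((u * b * (u : G)⁻¹ * b⁻¹)⁻¹ * (v * b * (v : G)⁻¹ * b⁻¹)) * a at h4
      rw [hdw] at h4
      have h5 : a * u = u * a := hAcomm a ha u u.2
      have h6 : a * w = w * a := hAcomm a ha w (mul_mem (inv_mem u.2) v.2)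
      have h5' : (u : G)⁻¹ * a = a * (u : G)⁻¹ := hAcomm _ (inv_mem u.2) a ha
      have h6' : w⁻¹ * a = a * w⁻¹ := hAcomm _ (inv_mem (mul_mem (inv_mem u.2) v.2)) a ha
      have h7 : a * (b⁻¹ * w * b * w⁻¹) = b⁻¹ * w * b * w⁻¹ * a := by
        apply mul_left_cancel (a := (u : G))
        apply mul_right_cancel (b := (u : G)⁻¹)
        calc (u : G) * (a * (b⁻¹ * w * b * w⁻¹)) * (u : G)⁻¹
            = (u * a) * (b⁻¹ * w * b * w⁻¹) * (u : G)⁻¹ := by group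
          _ = a * (u * (b⁻¹ * w * b * w⁻¹) * (u : G)⁻¹) := by rw [← h5]; group
          _ = u * (b⁻¹ * w * b * w⁻¹) * ((u : G)⁻¹ * a) := by rw [h4]; group
          _ = _ := by rw [h5']; group
      change _ ∈ Subgroup.centralizer {w}
      rw [Subgroup.mem_centralizer_iff]
      rintro _ rfl
      -- Conjugation by `a` fixes `w` and `b⁻¹ w b w⁻¹`, so `b` may be replaced by `a b a⁻¹`;
      -- comparing the two forms shows that `w` commutes with `[a, b]`.
      have h8 : (a * b⁻¹ * a⁻¹) * w * (a * b * a⁻¹) * w⁻¹ = b⁻¹ * w * b * w⁻¹ := by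
        apply mul_right_cancel (b := a)
        rw [← h7]
        calc (a * b⁻¹ * a⁻¹) * w * (a * b * a⁻¹) * w⁻¹ * a
            = (a * b⁻¹ * a⁻¹) * w * (a * b * a⁻¹) * (w⁻¹ * a) := by group
          _ = (a * b⁻¹ * a⁻¹) * (w * a) * b * w⁻¹ := by rw [h6']; group
          _ = _ := by rw [← h6]; group
      calc w * (a * b * a⁻¹ * b⁻¹)
          = (a * b * a⁻¹) * ((a * b⁻¹ * a⁻¹) * w * (a * b * a⁻¹) * w⁻¹) * w * b⁻¹ := by group
        _ = _ := by rw [h8]; group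
    intro m hm
    exact (Subgroup.mem_centralizer_iff.1 (h3 hm) _ rfl).symm
  have h2 : C.relIndex M = A.relIndex M := by
    have : C ⊓ M = A ⊓ M := by
      refine le_antisymm (inf_le_inf_right _ inf_le_left) fun x hx => ⟨⟨hx.1, ?_⟩, hx.2⟩
      exact Subgroup.mem_centralizer_iff.2 fun m hm => hMcomm m hm x hx.2
    rw [← Subgroup.inf_relIndex_right C, this, Subgroup.inf_relIndex_right]
  have h3 : C.relIndex M ≤ C.relIndex (M ⊔ C) :=
    Subgroup.relIndex_le_of_le_right le_sup_left
      (Nat.pos_iff_ne_zero.1 (Nat.pos_of_dvd_of_pos (Subgroup.relIndex_dvd_card _ _)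
        Nat.card_pos))
  calc Nat.card A = Nat.card C * C.relIndex A := by
        rw [← Subgroup.relIndex_bot_left, ← Subgroup.relIndex_bot_left,
          Subgroup.relIndex_mul_relIndex _ _ _ bot_le inf_le_left]
    _ ≤ Nat.card C * C.relIndex (M ⊔ C) := by gcongr; omega
    _ = Nat.card ↥(M ⊔ C) := by
        rw [← Subgroup.relIndex_bot_left, ← Subgroup.relIndex_bot_left,
          Subgroup.relIndex_mul_relIndex _ _ _ bot_le le_sup_right]

theorem mem_sup_iff_of_normalizes {H B : Subgroup G} (h : ∀ b ∈ B, ∀ x ∈ H, b * x * b⁻¹ ∈ H)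
    {x : G} : x ∈ H ⊔ B ↔ ∃ y ∈ H, ∃ b ∈ B, x = y * b := by
  constructor
  · intro hx
    let K : Subgroup G :=
      { carrier := {x | ∃ y ∈ H, ∃ b ∈ B, x = y * b}
        one_mem' := ⟨1, one_mem _, 1, one_mem _, by simp⟩
        mul_mem' := by
          rintro _ _ ⟨y, hy, b, hb, rfl⟩ ⟨y', hy', b', hb', rfl⟩
          exact ⟨y * (b * y' * b⁻¹), mul_mem hy (h b hb y' hy'), b * b', mul_mem hb hb', by group⟩
        inv_mem' := by
          rintro _ ⟨y, hy, b, hb, rfl⟩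
          exact ⟨b⁻¹ * y⁻¹ * b⁻¹⁻¹, h _ (inv_mem hb) _ (inv_mem hy), b⁻¹, inv_mem hb, by group⟩ }
    have : H ⊔ B ≤ K := sup_le (fun y hy => ⟨y, hy, 1, one_mem _, by simp⟩)
      fun b hb => ⟨1, one_mem _, b, hb, by simp⟩
    exact this hx
  · rintro ⟨y, hy, b, hb, rfl⟩
    exact Subgroup.mul_mem_sup hy hb

/-- **Thompson replacement** for a normal abelian subgroup `V`: if some abelian subgroup of maximum
order does not centralize `V`, then one such subgroup acts quadratically on `V`. -/
theorem exists_quadratic {p : ℕ} [Fact p.Prime] {N V : Subgroup G} [Finite N] (hN : IsPGroup p N)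
    (hVN : V ≤ N) (hV : IsMulCommutative V) (hnorm : ∀ n ∈ N, ∀ v ∈ V, n * v * n⁻¹ ∈ V)
    (hex : ∃ A, IsMaxAbelian N A ∧ ¬ A ≤ Subgroup.centralizer V) :
    ∃ A, IsMaxAbelian N A ∧ ¬ A ≤ Subgroup.centralizer V ∧
      ∀ v ∈ V, ∀ a ∈ A, ∀ a' ∈ A, a' * (a * v * a⁻¹ * v⁻¹) = (a * v * a⁻¹ * v⁻¹) * a' := by
  -- Among the candidates, `A` is chosen with `|A ⊓ V|` as large as possible.
  have hfin : ((fun A : Subgroup G => Nat.card ↥(A ⊓ V)) ''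
      {A : Subgroup G | IsMaxAbelian N A ∧ ¬ A ≤ Subgroup.centralizer V}).Finite := by
    refine (Set.finite_Iic (Nat.card N)).subset ?_
    rintro _ ⟨A, hA, rfl⟩
    exact Subgroup.card_le_of_le (inf_le_left.trans hA.1.1)
  obtain ⟨_, ⟨A, ⟨hA, hAV⟩, rfl⟩, hmax⟩ := hfin.exists_maximal
    (by obtain ⟨A, hA⟩ := hex; exact ⟨_, A, hA, rfl⟩)
  refine ⟨A, hA, hAV, ?_⟩
  have hVc := isMulCommutative_iff.1 hV
  have hAc := isMulCommutative_iff.1 hA.2.1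
  have hcomm : ∀ v ∈ V, ∀ a ∈ A, a * v * a⁻¹ * v⁻¹ ∈ V := fun v hv a ha =>
    mul_mem (hnorm a (hA.1 ha) v hv) (inv_mem hv)
  -- the normalizer of `A` in `V`
  let U : Subgroup G :=
    { carrier := {v | v ∈ V ∧ ∀ a ∈ A, a * v * a⁻¹ * v⁻¹ ∈ A}
      one_mem' := ⟨one_mem _, fun a _ => by simp⟩
      mul_mem' := by
        rintro x y ⟨hx, hx'⟩ ⟨hy, hy'⟩
        refine ⟨mul_mem hx hy, fun a ha => ?_⟩
        have h1 : a * (x * y) * a⁻¹ * (x * y)⁻¹ =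
            (a * x * a⁻¹ * x⁻¹) * (a * y * a⁻¹ * y⁻¹) := by
          calc _ = (a * x * a⁻¹ * x⁻¹) * (x * (a * y * a⁻¹ * y⁻¹)) * x⁻¹ := by group
            _ = _ := by rw [hVc x hx _ (hcomm y hy a ha)]; group
        rw [h1]
        exact mul_mem (hx' a ha) (hy' a ha)
      inv_mem' := by
        rintro x ⟨hx, hx'⟩
        refine ⟨inv_mem hx, fun a ha => ?_⟩
        have h1 : a * x⁻¹ * a⁻¹ * x⁻¹⁻¹ = (a * x * a⁻¹ * x⁻¹)⁻¹ := by
          have h2 := hVc x hx _ (hnorm a (hA.1 ha) _ (inv_mem hx))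
          rw [inv_inv, ← h2]
          group
        rw [h1]
        exact inv_mem (hx' a ha) }
  have hUV : U ≤ V := fun x hx => hx.1
  -- If all of `V` normalizes `A`, then `[V, A] ≤ A`, which is abelian.
  by_cases hUeq : U = V
  · intro v hv a ha a' ha'
    have : v ∈ U := hUeq ▸ hv
    exact hAc a' ha' _ (this.2 a ha)
  exfalso
  have hAU : ∀ a ∈ A, ∀ x ∈ U, a * x * a⁻¹ ∈ U := by
    intro a ha x hx
    refine ⟨hnorm a (hA.1 ha) x hx.1, fun a' ha' => ?_⟩
    have h1 : a' * (a * x * a⁻¹) * a'⁻¹ * (a * x * a⁻¹)⁻¹ =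
        a * (a' * x * a'⁻¹ * x⁻¹) * a⁻¹ := by
      calc _ = (a' * a) * x * (a' * a)⁻¹ * a * x⁻¹ * a⁻¹ := by group
        _ = _ := by rw [hAc a' ha' a ha]; group
    rw [h1]
    exact mul_mem (mul_mem ha (hx.2 a' ha')) (inv_mem ha)
  have hAVU : ∀ x ∈ A, x ∈ V → x ∈ U := fun x hx hxV => ⟨hxV, fun a ha =>
    mul_mem (mul_mem (mul_mem ha hx) (inv_mem ha)) (inv_mem hx)⟩
  have hlt : U ⊔ A < V ⊔ A := by
    refine lt_of_le_of_ne (sup_le_sup_right hUV _) fun heq => hUeq (le_antisymm hUV ?_)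
    intro v hv
    have : v ∈ U ⊔ A := heq ▸ le_sup_left (a := V) hv
    obtain ⟨u, hu, a, ha, rfl⟩ := (mem_sup_iff_of_normalizes hAU).1 this
    refine mul_mem hu (hAVU a ha ?_)
    simpa using mul_mem (inv_mem (hUV hu)) hv
  have hVA : V ⊔ A ≤ N := sup_le hVN hA.1
  have : Finite ↥(V ⊔ A) := Finite.of_injective _ (Subgroup.inclusion_injective hVA)
  -- Normalizers grow in the `p`-group `V A`, which gives `b` in `V` outside `U` with `[A, b] ≤ U A
  -- ⊓ V = U`.
  obtain ⟨k, hk, hk', hknorm⟩ := exists_normalizing (hN.to_le hVA) hlt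
  obtain ⟨b, hb, a₀, ha₀, rfl⟩ :=
    (mem_sup_iff_of_normalizes fun a ha => hnorm a (hA.1 ha)).1 hk
  have hbU : b ∉ U := fun h => hk' (Subgroup.mul_mem_sup h ha₀)
  have hab : ∀ a ∈ A, a * b * a⁻¹ * b⁻¹ ∈ U := by
    intro a ha
    have h1 : a * b * a⁻¹ * b⁻¹ ∈ U ⊔ A := by
      have h2 := hknorm (a₀⁻¹ * a⁻¹ * a₀) (le_sup_right (a := U)
        (mul_mem (mul_mem (inv_mem ha₀) (inv_mem ha)) ha₀))
      have h3 := mul_mem (le_sup_right (a := U) ha) h2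
      convert h3 using 1
      group
    obtain ⟨u, hu, a', ha', h2⟩ := (mem_sup_iff_of_normalizes hAU).1 h1
    rw [h2]
    refine mul_mem hu (hAVU a' ha' ?_)
    have h3 := mul_mem (inv_mem (hUV hu)) (hcomm b hb a ha)
    rw [h2] at h3
    simpa using h3
  set M := Subgroup.closure {y | ∃ a ∈ A, y = a * b * a⁻¹ * b⁻¹} with hM
  have hMU : M ≤ U := by
    rw [hM, Subgroup.closure_le]
    rintro _ ⟨a, ha, rfl⟩
    exact hab a ha
  have hMc : IsMulCommutative M := isMulCommutative_iff.2 fun x hx y hy =>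
    hVc x (hUV (hMU hx)) y (hUV (hMU hy))
  have hstar := hA.sup_centralizer hM (hMU.trans (hUV.trans hVN)) hMc
    fun m hm => hVc b hb m (hUV (hMU hm))
  have hcent : ∀ c ∈ A ⊓ Subgroup.centralizer (M : Set G), ∀ x ∈ M, c * x * c⁻¹ ∈ M := by
    intro c hc x hx
    rw [← Subgroup.mem_centralizer_iff.1 hc.2 x hx]
    simpa using hx
  set A' := M ⊔ (A ⊓ Subgroup.centralizer (M : Set G)) with hA'
  have hbA' : b ∉ A' := by
    intro h
    obtain ⟨m, hm, c, hc, rfl⟩ := (mem_sup_iff_of_normalizes hcent).1 h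
    refine hbU (mul_mem (hMU hm) (hAVU c hc.1 ?_))
    simpa using mul_mem (inv_mem (hUV (hMU hm))) hb
  have hle : A ⊓ V ≤ A' ⊓ V := by
    refine le_inf ?_ inf_le_right
    intro x hx
    refine le_sup_right (a := M) ⟨hx.1, Subgroup.mem_centralizer_iff.2 fun m hm => ?_⟩
    exact hVc m (hUV (hMU hm)) x hx.2
  have : Finite ↥(A' ⊓ V) :=
    Finite.of_injective _ (Subgroup.inclusion_injective (inf_le_right.trans hVN))
  -- If `A'` centralizes `V`, maximality of its order forces `b` into `A'`. If not, the choice of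
  -- `A` gives `A' ⊓ V = A ⊓ V`, so `[A, b] ≤ A` and `b` lies in `U`. Both are impossible.
  by_cases hA'V : A' ≤ Subgroup.centralizer V
  · refine hbA' (hstar.mem_of_commute (hVN hb) fun a ha => ?_)
    exact (Subgroup.mem_centralizer_iff.1 (hA'V ha) b hb).symm
  · have h1 := eq_of_le_of_card hle (hmax ⟨A', ⟨hstar, hA'V⟩, rfl⟩ (Subgroup.card_le_of_le hle))
    refine hbU ⟨hb, fun a ha => ?_⟩
    have h2 : a * b * a⁻¹ * b⁻¹ ∈ M := Subgroup.subset_closure ⟨a, ha, rfl⟩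
    have h3 : a * b * a⁻¹ * b⁻¹ ∈ A' ⊓ V := ⟨le_sup_left (b := A ⊓ _) h2, hcomm b hb a ha⟩
    rw [← h1] at h3
    exact h3.1

end GroupTheory

/-! ### Isomorphisms between subgroups, their restrictions and conjugations -/

section Iso

variable {G : Type*} [Group G]

open Classical in
/-- The value of `e : Q ≃* R` at an element of the ambient group, with value `1` outside of `Q`. -/
noncomputable def app {Q R : Subgroup G} (e : Q ≃* R) (x : G) : G :=
  if h : x ∈ Q then (e ⟨x, h⟩ : G) else 1

variable {Q R S A B : Subgroup G}

theorem app_of_mem (e : Q ≃* R) {x : G} (h : x ∈ Q) : app e x = e ⟨x, h⟩ := dif_pos h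

theorem app_coe (e : Q ≃* R) (x : Q) : app e x = e x := app_of_mem e x.2

theorem app_mem (e : Q ≃* R) {x : G} (h : x ∈ Q) : app e x ∈ R := by
  rw [app_of_mem e h]; exact (e _).2

theorem app_one (e : Q ≃* R) : app e 1 = 1 := by
  rw [app_of_mem e (one_mem _)]
  exact congrArg Subtype.val (map_one e)

theorem app_mul (e : Q ≃* R) {x y : G} (hx : x ∈ Q) (hy : y ∈ Q) :
    app e (x * y) = app e x * app e y := by
  rw [app_of_mem e (mul_mem hx hy), app_of_mem e hx, app_of_mem e hy]
  exact congrArg Subtype.val (map_mul e ⟨x, hx⟩ ⟨y, hy⟩)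

theorem app_inv (e : Q ≃* R) {x : G} (hx : x ∈ Q) : app e x⁻¹ = (app e x)⁻¹ := by
  rw [app_of_mem e (inv_mem hx), app_of_mem e hx]
  exact congrArg Subtype.val (map_inv e ⟨x, hx⟩)

theorem app_pow (e : Q ≃* R) {x : G} (hx : x ∈ Q) (n : ℕ) : app e (x ^ n) = app e x ^ n := by
  rw [app_of_mem e (pow_mem hx n), app_of_mem e hx]
  exact congrArg Subtype.val (map_pow e ⟨x, hx⟩ n)

theorem app_conj (e : Q ≃* R) {x y : G} (hx : x ∈ Q) (hy : y ∈ Q) :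
    app e (x * y * x⁻¹) = app e x * app e y * (app e x)⁻¹ := by
  rw [app_mul e (mul_mem hx hy) (inv_mem hx), app_mul e hx hy, app_inv e hx]

theorem app_trans (e : Q ≃* R) (f : R ≃* S) {x : G} (hx : x ∈ Q) :
    app (e.trans f) x = app f (app e x) := by
  rw [app_of_mem _ hx, app_of_mem e hx, app_coe]; rfl

theorem app_symm_app (e : Q ≃* R) {x : G} (hx : x ∈ Q) : app e.symm (app e x) = x := by
  rw [app_of_mem e hx, app_coe, MulEquiv.symm_apply_apply]

theorem app_app_symm (e : Q ≃* R) {x : G} (hx : x ∈ R) : app e (app e.symm x) = x :=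
  app_symm_app e.symm hx

theorem app_refl {x : G} (hx : x ∈ Q) : app (MulEquiv.refl Q) x = x := by
  rw [app_of_mem _ hx]; rfl

theorem app_mul_aut (α β : MulAut Q) {x : G} (hx : x ∈ Q) :
    app (α * β) x = app α (app β x) := app_trans β α hx

theorem app_one_aut {x : G} (hx : x ∈ Q) : app (1 : MulAut Q) x = x := app_refl hx

theorem app_inv_aut_app (α : MulAut Q) {x : G} (hx : x ∈ Q) : app α⁻¹ (app α x) = x :=
  app_symm_app α hx

theorem app_app_inv_aut (α : MulAut Q) {x : G} (hx : x ∈ Q) : app α (app α⁻¹ x) = x :=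
  app_app_symm α hx

theorem app_inj (e : Q ≃* R) {x y : G} (hx : x ∈ Q) (hy : y ∈ Q) (h : app e x = app e y) :
    x = y := by
  rw [← app_symm_app e hx, h, app_symm_app e hy]

theorem iso_ext {e f : Q ≃* R} (h : ∀ x ∈ Q, app e x = app f x) : e = f := by
  ext x
  have := h x x.2
  rwa [app_coe, app_coe] at this

/-- `f` is the restriction of `e`. -/
def IsRes {Q R A B : Subgroup G} (f : A ≃* B) (e : Q ≃* R) : Prop :=
  A ≤ Q ∧ ∀ x ∈ A, app f x = app e x

theorem IsRes.cod_le {f : A ≃* B} {e : Q ≃* R} (h : IsRes f e) : B ≤ R := by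
  intro y hy
  rw [← app_app_symm f hy, h.2 _ (app_mem _ hy)]
  exact app_mem e (h.1 (app_mem _ hy))

theorem IsRes.symm {f : A ≃* B} {e : Q ≃* R} (h : IsRes f e) : IsRes f.symm e.symm := by
  refine ⟨h.cod_le, fun y hy => ?_⟩
  have hx := app_mem f.symm hy
  refine app_inj e (h.1 hx) (app_mem _ (h.cod_le hy)) ?_
  rw [app_app_symm e (h.cod_le hy), ← h.2 _ hx, app_app_symm f hy]

/-- Codomains are produced existentially, so that a restriction or a conjugation is an isomorphism
onto its own image and no casts between equal subgroups arise. -/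
theorem exists_iso_of_hom (A : Subgroup G) (φ : A →* G) (hφ : Function.Injective φ) :
    ∃ (B : Subgroup G) (f : A ≃* B), ∀ x (hx : x ∈ A), app f x = φ ⟨x, hx⟩ :=
  ⟨φ.range, MonoidHom.ofInjective hφ, fun x hx => by rw [app_of_mem _ hx]; rfl⟩

theorem exists_res (e : Q ≃* R) (hA : A ≤ Q) : ∃ (B : Subgroup G) (f : A ≃* B), IsRes f e := by
  obtain ⟨B, f, hf⟩ := exists_iso_of_hom A
    (R.subtype.comp (e.toMonoidHom.comp (Subgroup.inclusion hA)))
    ((Subgroup.subtype_injective _).comp (e.injective.comp (Subgroup.inclusion_injective hA)))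
  exact ⟨B, f, hA, fun x hx => by rw [hf x hx, app_of_mem e (hA hx)]; rfl⟩

theorem exists_conj (A : Subgroup G) (n : G) :
    ∃ (B : Subgroup G) (f : A ≃* B), ∀ x ∈ A, app f x = n * x * n⁻¹ := by
  obtain ⟨B, f, hf⟩ := exists_iso_of_hom A ((MulAut.conj n).toMonoidHom.comp A.subtype)
    ((MulAut.conj n).injective.comp (Subgroup.subtype_injective _))
  exact ⟨B, f, fun x hx => hf x hx⟩

theorem cod_le_of_app (f : A ≃* B) (h : ∀ x ∈ A, app f x ∈ Q) : B ≤ Q := by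
  intro y hy
  rw [← app_app_symm f hy]
  exact h _ (app_mem _ hy)

theorem card_eq_of_iso (f : A ≃* B) : Nat.card A = Nat.card B := Nat.card_congr f.toEquiv

theorem finite_of_le (h : A ≤ B) [Finite B] : Finite A :=
  Finite.of_injective _ (Subgroup.inclusion_injective h)

theorem cod_eq_of_app (f : A ≃* B) (h : ∀ x ∈ A, app f x ∈ Q) [Finite Q]
    (hc : Nat.card Q ≤ Nat.card A) : B = Q :=
  eq_of_le_of_card (cod_le_of_app f h) (by rwa [← card_eq_of_iso f])

theorem exists_res_eq (e : Q ≃* R) (hA : A ≤ Q) [Finite B] (h : ∀ x ∈ A, app e x ∈ B)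
    (hc : Nat.card B ≤ Nat.card A) : ∃ f : A ≃* B, IsRes f e := by
  obtain ⟨C, f, hf⟩ := exists_res e hA
  obtain rfl := cod_eq_of_app f (Q := B) (fun x hx => by rw [hf.2 x hx]; exact h x hx) hc
  exact ⟨f, hf⟩

theorem exists_conj_eq [Finite A] {n : G} (h : ∀ x ∈ A, n * x * n⁻¹ ∈ A) :
    ∃ f : MulAut A, ∀ x ∈ A, app f x = n * x * n⁻¹ := by
  obtain ⟨B, f, hf⟩ := exists_conj A n
  obtain rfl := cod_eq_of_app f (Q := A) (fun x hx => by rw [hf x hx]; exact h x hx) le_rfl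
  exact ⟨f, hf⟩

theorem app_symm_mem_of_app_mem (e : Q ≃* R) (hA : A ≤ Q) [Finite B]
    (h : ∀ x ∈ A, app e x ∈ B) (hc : Nat.card B ≤ Nat.card A) :
    ∀ y ∈ B, app e.symm y ∈ A := by
  obtain ⟨f, hf⟩ := exists_res_eq e hA h hc
  intro y hy
  rw [← hf.symm.2 y hy]
  exact app_mem _ hy

instance [Finite Q] : Finite (MulAut Q) :=
  Finite.of_injective (fun e : MulAut Q => (e : Q → Q)) DFunLike.coe_injective

theorem mem_normalizerIn_iff {N Q : Subgroup G} [Finite Q] {x : G} :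
    x ∈ normalizerIn N Q ↔ x ∈ N ∧ ∀ z ∈ Q, x * z * x⁻¹ ∈ Q := by
  refine and_congr_right fun _ => ⟨fun h z hz => (Subgroup.mem_normalizer_iff.1 h z).1 hz,
    fun h => ?_⟩
  exact Subgroup.mem_normalizer_fintype h

/-- The automorphisms of `R` induced by conjugation by elements of `N`. -/
def conjAut (N R : Subgroup G) : Subgroup (MulAut R) where
  carrier := {α | ∃ n ∈ N, ∀ x ∈ R, app α x = n * x * n⁻¹}
  one_mem' := ⟨1, one_mem _, fun x hx => by rw [app_one_aut hx]; group⟩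
  mul_mem' := by
    rintro α β ⟨n, hn, h⟩ ⟨m, hm, h'⟩
    refine ⟨n * m, mul_mem hn hm, fun x hx => ?_⟩
    rw [app_mul_aut _ _ hx, h _ (app_mem β hx), h' x hx]
    group
  inv_mem' := by
    rintro α ⟨n, hn, h⟩
    refine ⟨n⁻¹, inv_mem hn, fun x hx => ?_⟩
    have := h _ (app_mem α⁻¹ hx)
    rw [app_app_inv_aut α hx] at this
    conv_rhs => rw [this]
    group

theorem app_pow_of_conj {R : Subgroup G} {α : MulAut R} {n : G}
    (h : ∀ x ∈ R, app α x = n * x * n⁻¹) (k : ℕ) :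
    ∀ x ∈ R, app (α ^ k) x = n ^ k * x * (n ^ k)⁻¹ := by
  induction k with
  | zero => intro x hx; rw [pow_zero, app_one_aut hx]; group
  | succ k ih =>
    intro x hx
    rw [pow_succ', app_mul_aut _ _ hx, h _ (app_mem _ hx), ih x hx, pow_succ']
    group

theorem isPGroup_conjAut {p : ℕ} {N : Subgroup G} (hN : IsPGroup p N) (R : Subgroup G) :
    IsPGroup p (conjAut N R) := by
  rintro ⟨α, n, hn, h⟩
  obtain ⟨k, hk⟩ := hN ⟨n, hn⟩
  refine ⟨k, Subtype.ext (iso_ext fun x hx => ?_)⟩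
  have hk' : n ^ p ^ k = 1 := congrArg Subtype.val hk
  have := app_pow_of_conj h (p ^ k) x hx
  rw [hk'] at this
  change app (α ^ p ^ k) x = app (1 : MulAut R) x
  rw [this, app_one_aut hx]
  group

/-! ### Local systems: saturation relative to a normal subgroup -/

/-- A family of isomorphisms between subgroups. -/
abbrev IsoFamily (G : Type*) [Group G] := ∀ Q R : Subgroup G, Set (Q ≃* R)

/-- `R` is fully automized and receptive in the family `E` on `N`. -/
structure Nice (p : ℕ) (N : Subgroup G) (E : IsoFamily G) (R : Subgroup G) : Prop where
  full : ∀ T : Subgroup (MulAut R), IsPGroup p T → (∀ α ∈ T, α ∈ E R R) →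
    ∃ β : MulAut R, β ∈ E R R ∧ ConjInto β T (conjAut N R)
  ext : ∀ {Q : Subgroup G} {e : Q ≃* R}, e ∈ E Q R → ∀ {T : Subgroup G}, T ≤ N → Q ≤ T →
    (∀ x ∈ T, ∀ z ∈ Q, x * z * x⁻¹ ∈ Q) →
    (∀ x ∈ T, ∃ y ∈ N, ∀ z ∈ Q, app e (x * z * x⁻¹) = y * app e z * y⁻¹) →
    ∃ (T' : Subgroup G) (f : T ≃* T'), f ∈ E T T' ∧ IsRes e f

/-- A saturated system of isomorphisms between the subgroups of the `p`-group `N` that contain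
a fixed normal subgroup `X`, all of which map `X` to itself. -/
structure IsLocalSystem (p : ℕ) (X N : Subgroup G) (E : IsoFamily G) : Prop where
  finite : Finite N
  isPGroup : IsPGroup p N
  le : X ≤ N
  norm : ∀ n ∈ N, ∀ x ∈ X, n * x * n⁻¹ ∈ X
  dom : ∀ {Q R : Subgroup G} {e : Q ≃* R}, e ∈ E Q R → X ≤ Q ∧ Q ≤ N
  symm : ∀ {Q R : Subgroup G} {e : Q ≃* R}, e ∈ E Q R → e.symm ∈ E R Q
  trans : ∀ {Q R S : Subgroup G} {e : Q ≃* R} {f : R ≃* S}, e ∈ E Q R → f ∈ E R S →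
    e.trans f ∈ E Q S
  res : ∀ {Q R A B : Subgroup G} {e : Q ≃* R} {f : A ≃* B}, e ∈ E Q R → IsRes f e → X ≤ A →
    f ∈ E A B
  pres : ∀ {Q R : Subgroup G} {e : Q ≃* R}, e ∈ E Q R → ∀ x ∈ X, app e x ∈ X
  conj : ∀ {Q R : Subgroup G} {e : Q ≃* R} {n : G}, n ∈ N → X ≤ Q → Q ≤ N →
    (∀ x ∈ Q, app e x = n * x * n⁻¹) → e ∈ E Q R
  nice : ∀ {Q : Subgroup G}, X ≤ Q → Q ≤ N → ∃ (R : Subgroup G) (e : Q ≃* R),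
    e ∈ E Q R ∧ Nice p N E R

namespace IsLocalSystem

variable {p : ℕ} {X N : Subgroup G} {E : IsoFamily G}

theorem cod (hE : IsLocalSystem p X N E) {e : Q ≃* R} (he : e ∈ E Q R) : X ≤ R ∧ R ≤ N :=
  hE.dom (hE.symm he)

theorem refl (hE : IsLocalSystem p X N E) (hX : X ≤ Q) (hQ : Q ≤ N) :
    MulEquiv.refl Q ∈ E Q Q :=
  hE.conj (one_mem _) hX hQ fun x hx => by rw [app_refl hx]; group

/-- The automorphism group of `R` in `E`. -/
def aut (hE : IsLocalSystem p X N E) (hX : X ≤ R) (hR : R ≤ N) : Subgroup (MulAut R) where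
  carrier := {α | α ∈ E R R}
  one_mem' := hE.refl hX hR
  mul_mem' := fun ha hb => hE.trans hb ha
  inv_mem' := fun ha => hE.symm ha

theorem finite_of_le (hE : IsLocalSystem p X N E) (h : Q ≤ N) : Finite Q :=
  have := hE.finite
  FusionSystem.finite_of_le h

/-- Up to an automorphism of a nice subgroup `R`, an isomorphism `Q → R` extends to `N_N(Q)`. -/
theorem exists_extension (hE : IsLocalSystem p X N E) {e₀ : Q ≃* R} (he₀ : e₀ ∈ E Q R)
    (hR : Nice p N E R) :
    ∃ (e : Q ≃* R) (T : Subgroup G) (f : normalizerIn N Q ≃* T),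
      e ∈ E Q R ∧ f ∈ E (normalizerIn N Q) T ∧ IsRes e f ∧ T ≤ normalizerIn N R := by
  have hQ := hE.dom he₀
  have := hE.finite_of_le hQ.2
  have := hE.finite_of_le (hE.cod he₀).2
  -- The automorphisms of `Q` induced by `N`, transported to `R`, form a `p`-group, which `β`
  -- conjugates into `conjAut N R`. After this correction receptivity applies to all of `N_N(Q)`.
  obtain ⟨β, hβ, hconj⟩ := hR.full ((conjAut N Q).map (MulAut.congr e₀).toMonoidHom)
    ((isPGroup_conjAut hE.isPGroup Q).map _) (by
      rintro _ ⟨α, ⟨n, hn, h⟩, rfl⟩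
      exact hE.trans (hE.symm he₀) (hE.trans (hE.conj hn hQ.1 hQ.2 h) he₀))
  have he : e₀.trans β ∈ E Q R := hE.trans he₀ hβ
  have hle : Q ≤ normalizerIn N Q := fun x hx => mem_normalizerIn_iff.2
    ⟨hQ.2 hx, fun z hz => mul_mem (mul_mem hx hz) (inv_mem hx)⟩
  obtain ⟨T, f, hf, hres⟩ := hR.ext he (T := normalizerIn N Q) inf_le_left hle
    (fun x hx z hz => (mem_normalizerIn_iff.1 hx).2 z hz) (by
      intro x hx
      have hx' := mem_normalizerIn_iff.1 hx
      obtain ⟨α, hα⟩ := exists_conj_eq hx'.2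
      obtain ⟨y, hy, h⟩ := hconj _ ⟨α, ⟨x, hx'.1, hα⟩, rfl⟩
      refine ⟨y, hy, fun z hz => ?_⟩
      have hz1 := app_mem e₀ hz
      rw [app_trans _ _ hz, ← h _ (app_mem β hz1), ← hα z hz, app_trans _ _ (app_mem α hz),
        app_mul_aut _ _ (app_mem β hz1), app_inv_aut_app β hz1, app_mul_aut _ _ hz1]
      congr 1
      change _ = app (e₀.symm.trans (α.trans e₀)) (app e₀ z)
      rw [app_trans _ _ hz1, app_symm_app e₀ hz, app_trans _ _ hz])
  refine ⟨_, T, f, he, hf, hres, fun t ht => mem_normalizerIn_iff.2 ⟨(hE.cod hf).2 ht, ?_⟩⟩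
  intro r hr
  have hx := app_mem f.symm ht
  have hz := app_mem (e₀.trans β).symm hr
  rw [← app_app_symm f ht, ← app_app_symm (e₀.trans β) hr, hres.2 _ hz,
    ← app_conj f hx (hle hz), ← hres.2 _ ((mem_normalizerIn_iff.1 hx).2 _ hz)]
  exact app_mem _ ((mem_normalizerIn_iff.1 hx).2 _ hz)

end IsLocalSystem

end Iso

/-! ### The normalizer of a nice subgroup is a local system -/

section Normalizer

variable {G : Type*} [Group G] {p : ℕ} {X N Q R S : Subgroup G} {E : IsoFamily G}

theorem app_congr (e : Q ≃* R) (α : MulAut Q) {x : G} (hx : x ∈ R) :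
    app (MulAut.congr e α) x = app e (app α (app e.symm x)) := by
  change app (e.symm.trans (α.trans e)) x = _
  rw [app_trans _ _ hx, app_trans _ _ (app_mem _ hx)]

/-- The members of the family `E` between subgroups of `N_N(R)` that contain `R`, and which
map `R` to itself. -/
def normFamily (N R : Subgroup G) (E : IsoFamily G) : IsoFamily G := fun Q S =>
  {e | e ∈ E Q S ∧ (R ≤ Q ∧ Q ≤ normalizerIn N R) ∧ (R ≤ S ∧ S ≤ normalizerIn N R) ∧
    ∀ x ∈ R, app e x ∈ R}

theorem app_symm_mem_self [Finite R] (e : Q ≃* S) (hR : R ≤ Q) (h : ∀ x ∈ R, app e x ∈ R) :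
    ∀ x ∈ R, app e.symm x ∈ R :=
  app_symm_mem_of_app_mem e hR h le_rfl

theorem le_cod_of_app [Finite R] (e : Q ≃* S) (hR : R ≤ Q) (h : ∀ x ∈ R, app e x ∈ R) :
    R ≤ S := by
  obtain ⟨f, hf⟩ := exists_res_eq e hR h le_rfl
  exact hf.cod_le

theorem le_normalizerIn_of [Finite R] {T : Subgroup G} (hT : T ≤ N)
    (h : ∀ t ∈ T, ∀ r ∈ R, t * r * t⁻¹ ∈ R) : T ≤ normalizerIn N R :=
  fun t ht => mem_normalizerIn_iff.2 ⟨hT ht, h t ht⟩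

namespace IsLocalSystem

/-- The conjugate `Q'` is reached in two moves. First `ρ` sends `Q` to a nice `Q₁`, taking a Sylow
subgroup of the stabilizer of `R` in Aut_E(Q) to conjugations by `N`, but sending `R` to some `R₁`.
Then `τ`, defined on `N_N(R₁)` because `R` is nice, brings `R₁` back to `R`. Niceness of `Q'` is
inherited from `Q₁` through `τ`. -/
theorem exists_nice_normFamily [Fact p.Prime] (hE : IsLocalSystem p X N E) (hX : X ≤ R)
    (hRN : R ≤ N) (hR : Nice p N E R) (hQR : R ≤ Q) (hQ : Q ≤ normalizerIn N R) :
    ∃ (Q' : Subgroup G) (σ : Q ≃* Q'),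
      σ ∈ normFamily N R E Q Q' ∧ Nice p (normalizerIn N R) (normFamily N R E) Q' := by
  have hQN : Q ≤ N := hQ.trans inf_le_left
  have hXQ := hX.trans hQR
  have := hE.finite_of_le hRN
  have := hE.finite_of_le hQN
  obtain ⟨Q₁, ρ₀, hρ₀, hQ₁⟩ := hE.nice hXQ hQN
  let AR : Subgroup (MulAut Q) :=
    { carrier := {α | α ∈ E Q Q ∧ ∀ x ∈ R, app α x ∈ R}
      one_mem' := ⟨hE.refl hXQ hQN, fun x hx => by rwa [app_one_aut (hQR hx)]⟩
      mul_mem' := fun {α β} ha hb => ⟨hE.trans hb.1 ha.1, fun x hx => by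
        rw [app_mul_aut _ _ (hQR hx)]; exact ha.2 _ (hb.2 x hx)⟩
      inv_mem' := fun {α} ha => ⟨hE.symm ha.1, app_symm_mem_self α hQR ha.2⟩ }
  obtain ⟨S₀, hS₀A, hS₀, -, hsyl⟩ := exists_sylow_of_le (p := p) (A := AR) (T := ⊥)
    IsPGroup.of_bot bot_le
  obtain ⟨β, hβ, hconj⟩ := hQ₁.full (S₀.map (MulAut.congr ρ₀).toMonoidHom) (hS₀.map _) (by
    rintro _ ⟨α, hα, rfl⟩
    exact hE.trans (hE.symm hρ₀) (hE.trans (hS₀A hα).1 hρ₀))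
  obtain ⟨ρ, hρ, hρS⟩ : ∃ ρ : Q ≃* Q₁, ρ ∈ E Q Q₁ ∧
      ∀ s ∈ S₀, MulAut.congr ρ s ∈ conjAut N Q₁ :=
    ⟨ρ₀.trans β, hE.trans hρ₀ hβ, fun s hs => hconj _ ⟨s, hs, rfl⟩⟩
  have hQ₁N := hE.cod hρ
  have := hE.finite_of_le hQ₁N.2
  obtain ⟨R₁, f, hf⟩ := exists_res ρ hQR
  have hfE : f ∈ E R R₁ := hE.res hρ hf hX
  have hR₁N := hE.cod hfE
  have := hE.finite_of_le hR₁N.2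
  obtain ⟨e, T, τ, heE, hτE, hτ, hTN⟩ := hE.exists_extension (hE.symm hfE) hR
  have hQ₁R₁ : Q₁ ≤ normalizerIn N R₁ := by
    refine le_normalizerIn_of hQ₁N.2 fun t ht r hr => ?_
    have h1 := app_mem ρ.symm ht
    have h2 := app_mem f.symm hr
    have h3 := (mem_normalizerIn_iff.1 (hQ h1)).2 _ h2
    rw [← app_app_symm ρ ht, ← app_app_symm f hr, hf.2 _ h2, ← app_conj ρ h1 (hQR h2),
      ← hf.2 _ h3]
    exact app_mem f h3
  obtain ⟨Q', g, hg⟩ := exists_res τ hQ₁R₁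
  have hgE : g ∈ E Q₁ Q' := hE.res hτE hg hQ₁N.1
  have hQ'N := hE.cod hgE
  have := hE.finite_of_le hQ'N.2
  have hR₁Q₁ : R₁ ≤ Q₁ := hf.cod_le
  have hgR : ∀ y ∈ R₁, app g y ∈ R := fun y hy => by
    rw [hg.2 y (hR₁Q₁ hy), ← hτ.2 y hy]
    exact app_mem e hy
  have hgR' : ∀ y ∈ R, app g.symm y ∈ R₁ :=
    app_symm_mem_of_app_mem g hR₁Q₁ hgR (card_eq_of_iso f).le
  have hσR : ∀ x ∈ R, app (ρ.trans g) x ∈ R := fun x hx => by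
    rw [app_trans _ _ (hQR hx), ← hf.2 x hx]
    exact hgR _ (app_mem f hx)
  have hRQ' : R ≤ Q' := le_cod_of_app _ hQR hσR
  have hQ'R : Q' ≤ normalizerIn N R := hg.cod_le.trans hTN
  set σ := ρ.trans g with hσdef
  have hσE : σ ∈ E Q Q' := hE.trans hρ hgE
  have hσ : σ ∈ normFamily N R E Q Q' := ⟨hσE, ⟨hQR, hQ⟩, ⟨hRQ', hQ'R⟩, hσR⟩
  have hσR' : ∀ x ∈ R, app σ.symm x ∈ R := app_symm_mem_self _ hQR hσR
  -- On `Q₁`, `s` becomes conjugation by some `n` in `N`. As `s` preserves `R`, `n` normalizes `R₁`,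
  -- so `τ` is defined at `n`, and `τ(n)` induces the required map on `Q'`.
  have hkey : ∀ s ∈ S₀, MulAut.congr σ s ∈ conjAut (normalizerIn N R) Q' := by
    intro s hs
    obtain ⟨n, hn, hns⟩ := hρS s hs
    have hn' : n ∈ normalizerIn N R₁ := by
      refine mem_normalizerIn_iff.2 ⟨hn, fun r hr => ?_⟩
      have h2 := app_mem f.symm hr
      have h3 : app ρ.symm r = app f.symm r := (hf.symm.2 r hr).symm
      have h4 := (hS₀A hs).2 _ h2
      rw [← hns r (hR₁Q₁ hr), app_congr _ _ (hR₁Q₁ hr), h3, ← hf.2 _ h4]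
      exact app_mem f h4
    refine ⟨app τ n, hTN (app_mem τ hn'), fun x hx => ?_⟩
    have hw := app_mem g.symm hx
    have h5 : app (MulAut.congr σ s) x = app g (app (MulAut.congr ρ s) (app g.symm x)) := by
      have h7 : app σ.symm x = app ρ.symm (app g.symm x) := app_trans g.symm ρ.symm hx
      rw [app_congr _ _ hx, h7, app_congr _ _ hw]
      exact app_trans ρ g (app_mem s (app_mem ρ.symm hw))
    have h6 : n * app g.symm x * n⁻¹ ∈ Q₁ := by
      rw [← hns _ hw]; exact app_mem _ hw
    rw [h5, hns _ hw, hg.2 _ h6, app_conj τ hn' (hQ₁R₁ hw), ← hg.2 _ hw, app_app_symm g hx]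
  refine ⟨Q', σ, hσ, ⟨?_, ?_⟩⟩
  · intro U hU hUE
    obtain ⟨β₀, hβ₀, hc⟩ := hsyl (U.map (MulAut.congr σ.symm).toMonoidHom) (hU.map _) (by
      rintro _ ⟨α, hα, rfl⟩
      refine ⟨hE.trans hσE (hE.trans (hUE α hα).1 (hE.symm hσE)), fun x hx => ?_⟩
      change app (MulAut.congr σ.symm α) x ∈ R
      rw [app_congr _ _ (hQR hx)]
      exact hσR' _ ((hUE α hα).2.2.2 _ (hσR x hx)))
    refine ⟨MulAut.congr σ β₀, ⟨hE.trans (hE.symm hσE) (hE.trans hβ₀.1 hσE), ⟨hRQ', hQ'R⟩,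
      ⟨hRQ', hQ'R⟩, fun x hx => ?_⟩, fun u hu => ?_⟩
    · rw [app_congr _ _ (hRQ' hx)]
      exact hσR _ (hβ₀.2 _ (hσR' x hx))
    · have h1 := hkey _ (hc _ ⟨u, hu, rfl⟩)
      rw [map_mul, map_mul, map_inv] at h1
      have h2 : MulAut.congr σ ((MulAut.congr σ.symm).toMonoidHom u) = u :=
        (MulAut.congr σ).apply_symm_apply u
      rwa [h2] at h1
  · intro Q₂ e' he' T₂ hT₂ hQT₂ hTQ₂ hy
    have hQ₂ := he'.2.1
    have he₁ : e'.trans g.symm ∈ E Q₂ Q₁ := hE.trans he'.1 (hE.symm hgE)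
    -- The inclusion from `hkey` is an equality since `S₀` is Sylow. Hence each conjugation of `Q'`
    -- by `N_N(R)` becomes a conjugation of `Q₁` by `N`, as receptivity of `Q₁` requires.
    have hU : S₀ = (conjAut (normalizerIn N R) Q').map (MulAut.congr σ.symm).toMonoidHom := by
      refine eq_of_le_of_card ?_ ?_
      · intro s hs
        exact ⟨MulAut.congr σ s, hkey s hs, (MulAut.congr σ).symm_apply_apply s⟩
      · obtain ⟨β₀, -, hc⟩ := hsyl ((conjAut (normalizerIn N R) Q').map
          (MulAut.congr σ.symm).toMonoidHom)
          ((isPGroup_conjAut (hE.isPGroup.to_le inf_le_left) Q').map _) (by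
            rintro _ ⟨α, ⟨n, hn, hα⟩, rfl⟩
            have hn' := mem_normalizerIn_iff.1 hn
            refine ⟨hE.trans hσE (hE.trans (hE.conj hn'.1 hQ'N.1 hQ'N.2 hα) (hE.symm hσE)),
              fun x hx => ?_⟩
            change app (MulAut.congr σ.symm α) x ∈ R
            rw [app_congr _ _ (hQR hx)]
            refine hσR' _ ?_
            have h2 := hn'.2 _ (hσR x hx)
            rwa [← hα _ (hRQ' (hσR x hx))] at h2)
        exact hc.card_le
    obtain ⟨T₁, f₁, hf₁E, hf₁⟩ := hQ₁.ext he₁ (hT₂.trans inf_le_left) hQT₂ hTQ₂ (by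
      intro x hx
      obtain ⟨y, hyN, h⟩ := hy x hx
      have hyQ' : ∀ z ∈ Q', y * z * y⁻¹ ∈ Q' := by
        intro z hz
        have hz' := app_mem e'.symm hz
        rw [← app_app_symm e' hz, ← h _ hz']
        exact app_mem _ (hTQ₂ x hx _ hz')
      obtain ⟨α, hα⟩ := exists_conj_eq hyQ'
      have hα' : (MulAut.congr σ.symm) α ∈ S₀ := by
        rw [hU]
        exact ⟨α, ⟨y, hyN, hα⟩, rfl⟩
      obtain ⟨y', hy', h'⟩ := hρS _ hα'
      refine ⟨y', hy', fun z hz => ?_⟩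
      have hez := app_mem e' hz
      have hw := app_mem g.symm hez
      have hρw := app_mem ρ.symm hw
      have h1 : app σ (app ρ.symm (app g.symm (app e' z))) = app e' z := by
        rw [hσdef, app_trans _ _ hρw, app_app_symm ρ hw, app_app_symm g hez]
      have h2 : ∀ u ∈ Q', app ρ (app σ.symm u) = app g.symm u := by
        intro u hu
        change app ρ (app (g.symm.trans ρ.symm) u) = _
        rw [app_trans _ _ hu, app_app_symm ρ (app_mem _ hu)]
      rw [app_trans _ _ (hTQ₂ x hx z hz), app_trans _ _ hz, ← h' _ hw, app_congr _ _ hw,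
        app_congr _ _ hρw]
      change _ = app ρ (app σ.symm (app α (app σ _)))
      rw [h1, h2 _ (app_mem α hez), hα _ hez, h z hz])
    have hf₁e : ∀ x ∈ Q₂, app f₁ x = app g.symm (app e' x) := fun x hx => by
      rw [← hf₁.2 x hx, app_trans _ _ hx]
    -- The extension obtained for `Q₁` ends in `N_N(R₁)`, where `τ` can be applied to return to
    -- `N_N(R)`.
    have hT₁ : T₁ ≤ normalizerIn N R₁ := by
      refine le_normalizerIn_of (hE.cod hf₁E).2 fun t ht r hr => ?_
      have hx := app_mem f₁.symm ht
      have hr' : app e'.symm (app g r) ∈ R :=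
        app_symm_mem_self e' hQ₂.1 he'.2.2.2 _ (hgR r hr)
      have h1 : app f₁ (app e'.symm (app g r)) = r := by
        rw [hf₁e _ (hQ₂.1 hr'), app_app_symm e' (hRQ' (hgR r hr)), app_symm_app g (hR₁Q₁ hr)]
      have h2 := (mem_normalizerIn_iff.1 (hT₂ hx)).2 _ hr'
      rw [← app_app_symm f₁ ht, ← h1, ← app_conj f₁ hx (hQT₂ (hQ₂.1 hr')), hf₁e _ (hQ₂.1 h2)]
      exact hgR' _ (he'.2.2.2 _ h2)
    obtain ⟨T₃, h, hh⟩ := exists_res τ hT₁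
    have hhE : h ∈ E T₁ T₃ := hE.res hτE hh (hE.cod hf₁E).1
    have hfin : IsRes e' (f₁.trans h) := by
      refine ⟨hQT₂, fun x hx => ?_⟩
      have h1 := app_mem g.symm (app_mem e' hx)
      rw [app_trans _ _ (hQT₂ hx), hh.2 _ (app_mem f₁ (hQT₂ hx)), hf₁e x hx, ← hg.2 _ h1,
        app_app_symm g (app_mem e' hx)]
    have hpres : ∀ x ∈ R, app (f₁.trans h) x ∈ R := fun x hx => by
      rw [← hfin.2 x (hQ₂.1 hx)]
      exact he'.2.2.2 x hx
    exact ⟨T₃, f₁.trans h, ⟨hE.trans hf₁E hhE, ⟨hQ₂.1.trans hQT₂, hT₂⟩,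
      ⟨hRQ'.trans hfin.cod_le, hh.cod_le.trans hTN⟩, hpres⟩, hfin⟩

/-- The normalizer of a nice subgroup is again a saturated system. -/
theorem normFamily [Fact p.Prime] (hE : IsLocalSystem p X N E) (hX : X ≤ R) (hRN : R ≤ N)
    (hR : Nice p N E R) :
    IsLocalSystem p R (normalizerIn N R) (FusionSystem.normFamily N R E) := by
  have := hE.finite_of_le hRN
  have hn : ∀ n ∈ normalizerIn N R, ∀ x ∈ R, n * x * n⁻¹ ∈ R :=
    fun n hn => (mem_normalizerIn_iff.1 hn).2
  refine ⟨hE.finite_of_le inf_le_left, hE.isPGroup.to_le inf_le_left, ?_, hn,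
    fun h => h.2.1, ?_, ?_, ?_, fun h => h.2.2.2, ?_, ?_⟩
  · exact le_normalizerIn_of hRN fun t ht r hr => mul_mem (mul_mem ht hr) (inv_mem ht)
  · intro Q S e h
    exact ⟨hE.symm h.1, h.2.2.1, h.2.1, app_symm_mem_self e h.2.1.1 h.2.2.2⟩
  · intro Q S T e f h h'
    refine ⟨hE.trans h.1 h'.1, h.2.1, h'.2.2.1, fun x hx => ?_⟩
    rw [app_trans _ _ (h.2.1.1 hx)]
    exact h'.2.2.2 _ (h.2.2.2 x hx)
  · intro Q S A B e f h hres hA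
    have hp : ∀ x ∈ R, app f x ∈ R := fun x hx => by
      rw [hres.2 x (hA hx)]; exact h.2.2.2 x hx
    exact ⟨hE.res h.1 hres (hX.trans hA), ⟨hA, hres.1.trans h.2.1.2⟩,
      ⟨le_cod_of_app f hA hp, hres.cod_le.trans h.2.2.1.2⟩, hp⟩
  · intro Q S e n hnN hRQ hQ h
    have hp : ∀ x ∈ R, app e x ∈ R := fun x hx => by
      rw [h x (hRQ hx)]; exact hn n hnN x hx
    exact ⟨hE.conj hnN.1 (hX.trans hRQ) (hQ.trans inf_le_left) h, ⟨hRQ, hQ⟩,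
      ⟨le_cod_of_app e hRQ hp, cod_le_of_app e fun x hx => by
        rw [h x hx]; exact mul_mem (mul_mem hnN (hQ hx)) (inv_mem hnN)⟩, hp⟩
  · exact fun h1 h2 => hE.exists_nice_normFamily hX hRN hR h1 h2

end IsLocalSystem

end Normalizer

/-! ### The Thompson subgroup under isomorphisms, and Alperin's fusion theorem -/

section Alperin

variable {G : Type*} [Group G] {p : ℕ} {X N Q R S : Subgroup G} {E H : IsoFamily G}

/-- The elements of `Q` mapped into `B` by `e : Q → R`. -/
def preimage (e : Q ≃* R) (B : Subgroup G) : Subgroup G where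
  carrier := {x | x ∈ Q ∧ app e x ∈ B}
  one_mem' := ⟨one_mem _, by rw [app_one]; exact one_mem _⟩
  mul_mem' := fun ha hb => ⟨mul_mem ha.1 hb.1, by
    rw [app_mul e ha.1 hb.1]; exact mul_mem ha.2 hb.2⟩
  inv_mem' := fun ha => ⟨inv_mem ha.1, by rw [app_inv e ha.1]; exact inv_mem ha.2⟩

/-- The elements of `Q` fixed by `e : Q → R`. -/
def fixedBy (e : Q ≃* R) : Subgroup G where
  carrier := {x | x ∈ Q ∧ app e x = x}
  one_mem' := ⟨one_mem _, app_one e⟩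
  mul_mem' := fun ha hb => ⟨mul_mem ha.1 hb.1, by rw [app_mul e ha.1 hb.1, ha.2, hb.2]⟩
  inv_mem' := fun ha => ⟨inv_mem ha.1, by rw [app_inv e ha.1, ha.2]⟩

/-- Isomorphisms preserve order and commutativity, so abelian subgroups of maximum order in `N` go
to such subgroups again. -/
theorem app_mem_thompson [Finite N] (e : Q ≃* R) (hQ : thompson N ≤ Q) (hR : R ≤ N) :
    ∀ x ∈ thompson N, app e x ∈ thompson N := by
  have h : thompson N ≤ preimage e (thompson N) := by
    refine sSup_le fun A hA => ?_
    have hAQ : A ≤ Q := (IsMaxAbelian.le_thompson hA).trans hQ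
    obtain ⟨B, f, hf⟩ := exists_res e hAQ
    have hB : IsMaxAbelian N B := by
      refine ⟨hf.cod_le.trans hR, isMulCommutative_iff.2 fun x hx y hy => ?_, fun C hC hC' => ?_⟩
      · have hx' := app_mem f.symm hx
        have hy' := app_mem f.symm hy
        rw [← app_app_symm f hx, ← app_app_symm f hy, ← app_mul f hx' hy',
          isMulCommutative_iff.1 hA.2.1 _ hx' _ hy', app_mul f hy' hx']
      · rw [← card_eq_of_iso f]; exact hA.2.2 C hC hC'
    intro x hx
    refine ⟨hAQ hx, hB.le_thompson ?_⟩
    rw [← hf.2 x hx]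
    exact app_mem f hx
  exact fun x hx => (h hx).2

theorem conj_mem_thompson [Finite N] {n : G} (hn : ∀ x ∈ N, n * x * n⁻¹ ∈ N) :
    ∀ x ∈ thompson N, n * x * n⁻¹ ∈ thompson N := by
  obtain ⟨f, hf⟩ := exists_conj_eq hn
  intro x hx
  rw [← hf x (thompson_le N hx)]
  exact app_mem_thompson f (thompson_le N) le_rfl x hx

/-- By maximality, a central subgroup lies in every abelian subgroup of maximum order. -/
theorem le_thompson_of_central [Finite N] {Z : Subgroup G} (hZ : Z ≤ N)
    (hc : ∀ n ∈ N, ∀ z ∈ Z, n * z = z * n) : Z ≤ thompson N := by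
  obtain ⟨A, hA⟩ := exists_isMaxAbelian N
  exact (hA.le_of_commute hZ (isMulCommutative_iff.2 fun x hx y hy => hc x (hZ hx) y hy)
    fun a ha b hb => hc a (hA.1 ha) b hb).trans hA.le_thompson

/-- A family of isomorphisms closed under inverses, composition and restriction. -/
structure IsClosedFamily (H : IsoFamily G) : Prop where
  symm : ∀ {Q R : Subgroup G} {e : Q ≃* R}, e ∈ H Q R → e.symm ∈ H R Q
  trans : ∀ {Q R S : Subgroup G} {e : Q ≃* R} {f : R ≃* S}, e ∈ H Q R → f ∈ H R S →
    e.trans f ∈ H Q S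
  res : ∀ {Q R A B : Subgroup G} {e : Q ≃* R} {f : A ≃* B}, e ∈ H Q R → IsRes f e → f ∈ H A B

theorem IsClosedFamily.mem_of_conj {Q' S' : Subgroup G} (hH : IsClosedFamily H) {e : Q ≃* S}
    {f : Q ≃* Q'} {g : S ≃* S'} (hf : f ∈ H Q Q') (hg : g ∈ H S S')
    (h : f.symm.trans (e.trans g) ∈ H Q' S') : e ∈ H Q S := by
  have h1 := hH.trans hf (hH.trans h (hH.symm hg))
  convert h1 using 1
  ext x
  simp

theorem le_normalizerIn_self (h : R ≤ N) : R ≤ normalizerIn N R :=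
  le_inf h Subgroup.le_normalizer

theorem card_lt_of_lt {A B : Subgroup G} [Finite B] (h : A < B) : Nat.card A < Nat.card B := by
  refine lt_of_le_of_ne (Subgroup.card_le_of_le h.le) fun hc => h.ne ?_
  exact eq_of_le_of_card h.le hc.ge

namespace IsLocalSystem

theorem card_lt_normalizerIn [Fact p.Prime] (hE : IsLocalSystem p X N E) (h : Q < N) :
    Nat.card Q < Nat.card (normalizerIn N Q) := by
  have := hE.finite
  have := hE.finite_of_le h.le
  have : Finite (normalizerIn N Q) := hE.finite_of_le inf_le_left
  obtain ⟨k, hk, hkQ, hnorm⟩ := exists_normalizing hE.isPGroup h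
  refine card_lt_of_lt (lt_of_le_of_ne (le_normalizerIn_self h.le) fun heq => hkQ ?_)
  rw [heq]
  exact mem_normalizerIn_iff.2 ⟨hk, hnorm⟩

/-- **Alperin's fusion theorem**: the family `H` contains `E` if it contains the automorphism groups
of the nice subgroups, given the isomorphisms between larger subgroups. -/
theorem alperin [Fact p.Prime] (hE : IsLocalSystem p X N E) (hH : IsClosedFamily H)
    (hN : ∀ {S : Subgroup G} {e : N ≃* S}, e ∈ E N S → e ∈ H N S) (k : ℕ)
    (haut : ∀ R : Subgroup G, X ≤ R → R ≤ N → k ≤ Nat.card R → Nice p N E R →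
      (∀ {T S : Subgroup G} {e : T ≃* S}, e ∈ E T S → Nat.card R < Nat.card T → e ∈ H T S) →
      ∀ α ∈ E R R, α ∈ H R R) :
    ∀ {Q S : Subgroup G} {e : Q ≃* S}, e ∈ E Q S → k ≤ Nat.card Q → e ∈ H Q S := by
  have := hE.finite
  suffices h : ∀ (m : ℕ) {Q S : Subgroup G} {e : Q ≃* S}, e ∈ E Q S → k ≤ Nat.card Q →
      Nat.card N < m + Nat.card Q → e ∈ H Q S from
    fun {Q S e} he hk => h (Nat.card N + 1) he hk (by omega)
  intro m
  induction m with
  | zero =>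
    intro Q S e he hk hm
    have := Subgroup.card_le_of_le (hE.dom he).2
    omega
  | succ m ih =>
    intro Q S e he hk hm
    have hbig : ∀ {T U : Subgroup G} {f : T ≃* U}, f ∈ E T U → Nat.card Q < Nat.card T →
        f ∈ H T U := fun hf hc => ih hf (by omega) (by omega)
    have hQ := hE.dom he
    have hS := hE.cod he
    by_cases hQN : Q = N
    · subst hQN
      exact hN he
    have hQlt : Q < N := lt_of_le_of_ne hQ.2 hQN
    have hcard := card_eq_of_iso e
    have hSlt : S < N := by
      refine lt_of_le_of_ne hS.2 fun h => ?_
      have := card_lt_of_lt hQlt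
      rw [hcard, h] at this
      exact this.false
    -- `Q` and `S` both map to one nice `R` by isomorphisms that extend to their normalizers in `N`.
    -- These have larger domains, so the induction covers them, and only an automorphism of `R`
    -- remains.
    obtain ⟨R, e₀, he₀, hR⟩ := hE.nice hQ.1 hQ.2
    obtain ⟨e₁, T₁, f₁, he₁, hf₁, hres₁, -⟩ := hE.exists_extension he₀ hR
    obtain ⟨e₂, T₂, f₂, he₂, hf₂, hres₂, -⟩ :=
      hE.exists_extension (hE.trans (hE.symm he) he₀) hR
    have h1 : e₁ ∈ H Q R := hH.res (hbig hf₁ (hE.card_lt_normalizerIn hQlt)) hres₁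
    have h2 : e₂ ∈ H S R := by
      refine hH.res (hbig hf₂ ?_) hres₂
      rw [hcard]
      exact hE.card_lt_normalizerIn hSlt
    have hRN := hE.cod he₀
    have hcR : Nat.card Q = Nat.card R := card_eq_of_iso e₀
    refine hH.mem_of_conj h1 h2 (haut R hRN.1 hRN.2 (hcR ▸ hk) hR ?_ _
      (hE.trans (hE.symm he₁) (hE.trans he he₂)))
    intro T U f hf hc
    exact hbig hf (hcR ▸ hc)

/-- If the normalizers of the nice subgroups that are conjugate to `Y` are in `H`, so is the
normalizer of `Y`. -/
theorem normFamily_subset_of_conj (hE : IsLocalSystem p X N E)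
    (hH : IsClosedFamily H) {Y : Subgroup G} (hXY : X ≤ Y) (hY : Y ≤ N)
    (hN : ∀ {S : Subgroup G} {e : normalizerIn N Y ≃* S}, e ∈ E (normalizerIn N Y) S →
      e ∈ H (normalizerIn N Y) S)
    (hnice : ∀ Y' : Subgroup G, X ≤ Y' → Y' ≤ N → Nat.card Y' = Nat.card Y →
      Nat.card (normalizerIn N Y) ≤ Nat.card (normalizerIn N Y') → Nice p N E Y' →
      ∀ {Q S : Subgroup G} {e : Q ≃* S}, e ∈ FusionSystem.normFamily N Y' E Q S → e ∈ H Q S) :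
    ∀ {Q S : Subgroup G} {e : Q ≃* S}, e ∈ FusionSystem.normFamily N Y E Q S → e ∈ H Q S := by
  intro Q S φ hφ
  have := hE.finite
  have := hE.finite_of_le hY
  obtain ⟨Y', e₀, he₀, hY'⟩ := hE.nice hXY hY
  have hY'N := hE.cod he₀
  have := hE.finite_of_le hY'N.2
  have : Finite (normalizerIn N Y') := hE.finite_of_le inf_le_left
  -- The extension `τ` to `N_N(Y)` conjugates the maps normalizing `Y` to maps normalizing `Y'`.
  obtain ⟨e, T, τ, he, hτ, hres, hT⟩ := hE.exists_extension he₀ hY'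
  have hτH := hN hτ
  obtain ⟨Q', f, hf⟩ := exists_res τ hφ.2.1.2
  obtain ⟨S', g, hg⟩ := exists_res τ hφ.2.2.1.2
  have hYQ := hφ.2.1.1
  have hYS := hφ.2.2.1.1
  have hfe : ∀ x ∈ Y, app f x = app e x := fun x hx => by rw [hf.2 x (hYQ hx), hres.2 x hx]
  have hge : ∀ x ∈ Y, app g x = app e x := fun x hx => by rw [hg.2 x (hYS hx), hres.2 x hx]
  have hY'Q' : Y' ≤ Q' := fun y hy => by
    rw [← app_app_symm e hy, ← hfe _ (app_mem _ hy)]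
    exact app_mem f (hYQ (app_mem _ hy))
  have hY'S' : Y' ≤ S' := fun y hy => by
    rw [← app_app_symm e hy, ← hge _ (app_mem _ hy)]
    exact app_mem g (hYS (app_mem _ hy))
  have hfE : f ∈ E Q Q' := hE.res hτ hf (hXY.trans hYQ)
  have hgE : g ∈ E S S' := hE.res hτ hg (hXY.trans hYS)
  refine hH.mem_of_conj (hH.res hτH hf) (hH.res hτH hg)
    (hnice Y' hY'N.1 hY'N.2 (card_eq_of_iso e).symm ?_ hY'
      ⟨hE.trans (hE.symm hfE) (hE.trans hφ.1 hgE), ⟨hY'Q', hf.cod_le.trans hT⟩,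
        ⟨hY'S', hg.cod_le.trans hT⟩, ?_⟩)
  · rw [card_eq_of_iso τ]
    exact Subgroup.card_le_of_le hT
  · intro x hx
    have h1 := app_mem e.symm hx
    have h2 : app f.symm x = app e.symm x := by
      refine app_inj f (app_mem _ (hY'Q' hx)) (hYQ h1) ?_
      rw [app_app_symm f (hY'Q' hx), hfe _ h1, app_app_symm e hx]
    rw [app_trans _ _ (hY'Q' hx), app_trans _ _ (app_mem _ (hY'Q' hx)), h2,
      hge _ (hφ.2.2.2 _ h1)]
    exact app_mem e (hφ.2.2.2 _ h1)

end IsLocalSystem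

end Alperin

/-! ### The case where the central subgroup Z is not contained in X -/

section NotLe

variable {G : Type*} [Group G] {p : ℕ} {X N Q R S Z : Subgroup G} {E H : IsoFamily G}

namespace IsLocalSystem

theorem normalizerIn_eq (hE : IsLocalSystem p X N E)
    (h : Nat.card N ≤ Nat.card (normalizerIn N R)) : normalizerIn N R = N :=
  have := hE.finite
  eq_of_le_of_card inf_le_left h

/-- The assumption on `Z` serves twice: automorphisms of `X` extend to the larger `X Z`, and `X
J(N_N(R))` properly contains `X` because Thompson subgroups contain `Z`. -/
theorem subset_of_not_le [Fact p.Prime] (hE : IsLocalSystem p X N E) (hH : IsClosedFamily H)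
    (hZN : Z ≤ N) (hZ : ∀ n ∈ N, ∀ z ∈ Z, n * z = z * n) (hZX : ¬ Z ≤ X)
    (hthompson : ∀ {Q S : Subgroup G} {e : Q ≃* S}, e ∈ E Q S → thompson N ≤ Q → e ∈ H Q S)
    (ih : ∀ R : Subgroup G, X < R → R ≤ N → Nice p N E R →
      (∀ {Q S : Subgroup G} {e : Q ≃* S}, e ∈ FusionSystem.normFamily N R E Q S →
        thompson (normalizerIn N R) ≤ Q → e ∈ H Q S) →
      ∀ {Q S : Subgroup G} {e : Q ≃* S}, e ∈ FusionSystem.normFamily N R E Q S → e ∈ H Q S) :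
    ∀ {Q S : Subgroup G} {e : Q ≃* S}, e ∈ E Q S → e ∈ H Q S := by
  have := hE.finite
  have := hE.finite_of_le hE.le
  have hN : ∀ {S : Subgroup G} {e : N ≃* S}, e ∈ E N S → e ∈ H N S :=
    fun he => hthompson he (thompson_le N)
  have hXZ : X < X ⊔ Z := lt_of_le_of_ne le_sup_left fun h => hZX (h ▸ le_sup_right)
  have hlt_of_card : ∀ {R : Subgroup G}, X ≤ R → Nat.card X < Nat.card R → X < R :=
    fun h hc => lt_of_le_of_ne h fun h' => by rw [h'] at hc; exact hc.false
  have haut_of : ∀ {R : Subgroup G}, X ≤ R → R ≤ N →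
      (∀ {Q S : Subgroup G} {e : Q ≃* S}, e ∈ FusionSystem.normFamily N R E Q S → e ∈ H Q S) →
      ∀ α ∈ E R R, α ∈ H R R := by
    intro R hXR hRN h α hα
    exact h ⟨hα, ⟨le_rfl, le_normalizerIn_self hRN⟩, ⟨le_rfl, le_normalizerIn_self hRN⟩,
      fun x hx => app_mem α hx⟩
  -- Downward induction on `|N_N(R)|`, with `m` bounding how far it is from `|N|`.
  have hclaim : ∀ (m : ℕ) (R : Subgroup G), X < R → R ≤ N → Nice p N E R →
      Nat.card N < m + Nat.card (normalizerIn N R) →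
      ∀ {Q S : Subgroup G} {e : Q ≃* S}, e ∈ FusionSystem.normFamily N R E Q S → e ∈ H Q S := by
    intro m
    induction m with
    | zero =>
      intro R _ _ _ hm
      have h1 : Nat.card (normalizerIn N R) ≤ Nat.card N := Subgroup.card_le_of_le inf_le_left
      omega
    | succ m hm =>
      intro R hXR hRN hR hc
      by_cases hRn : normalizerIn N R = N
      · refine ih R hXR hRN hR fun he hJ => hthompson he.1 ?_
        rwa [hRn] at hJ
      have hlt : normalizerIn N R < N := lt_of_le_of_ne inf_le_left hRn
      have : Finite (normalizerIn N R) := hE.finite_of_le inf_le_left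
      refine ih R hXR hRN hR ?_
      intro Q S e he hJQ
      have hRle := le_normalizerIn_self hRN
      have hXQ : X ≤ Q := hXR.le.trans he.2.1.1
      set J := thompson (normalizerIn N R) with hJ
      have hZJ : Z ≤ J := by
        have hZR : Z ≤ normalizerIn N R := le_inf hZN fun z hz => by
          rw [Subgroup.mem_normalizer_iff]
          intro r
          have : r ∈ N → z * r * z⁻¹ = r := fun hr => by rw [← hZ r hr z hz]; group
          refine ⟨fun hr => by rwa [this (hRN hr)], fun hr => ?_⟩
          have h2 : r ∈ N := by
            have := mul_mem (mul_mem (inv_mem (hZN hz)) (hRN hr)) (hZN hz)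
            simpa [mul_assoc] using this
          rwa [this h2] at hr
        exact le_thompson_of_central hZR fun n hn => hZ n hn.1
      have hJN : J ≤ N := (thompson_le _).trans inf_le_left
      have hYN : X ⊔ J ≤ N := sup_le hE.le hJN
      have := hE.finite_of_le hYN
      have hXY : X < X ⊔ J := hXZ.trans_le (sup_le_sup_left hZJ _)
      have hstab : ∀ n ∈ N, (∀ x ∈ normalizerIn N R, n * x * n⁻¹ ∈ normalizerIn N R) →
          n ∈ normalizerIn N (X ⊔ J) := by
        intro n hn h
        refine mem_normalizerIn_iff.2 ⟨hn, ?_⟩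
        have h1 : X ⊔ J ≤ (X ⊔ J).comap (MulAut.conj n).toMonoidHom :=
          sup_le (fun x hx => le_sup_left (b := J) (hE.norm n hn x hx))
            fun x hx => le_sup_right (a := X) (conj_mem_thompson h x hx)
        exact fun x hx => h1 hx
      have hle : normalizerIn N R ≤ normalizerIn N (X ⊔ J) := fun n hn =>
        hstab n hn.1 fun x hx => mul_mem (mul_mem hn hx) (inv_mem hn)
      -- Anything in `N` normalizing `N_N(R)` normalizes both `X` and its Thompson subgroup `J`, and
      -- `N_N(R)` is not its own normalizer in `N`.
      have hlt' : normalizerIn N R < normalizerIn N (X ⊔ J) := by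
        obtain ⟨k, hk, hkR, hnorm⟩ := exists_normalizing hE.isPGroup hlt
        refine lt_of_le_of_ne hle fun h => hkR ?_
        rw [h]
        exact hstab k hk hnorm
      have : Finite (normalizerIn N (X ⊔ J)) := hE.finite_of_le inf_le_left
      have hcard := card_lt_of_lt hlt'
      have hcX : Nat.card X ≤ Nat.card (normalizerIn N R) :=
        Subgroup.card_le_of_le (hXR.le.trans hRle)
      refine hE.normFamily_subset_of_conj hH hXY.le hYN ?_ ?_ (Q := Q) (S := S) ⟨he.1,
        ⟨sup_le hXQ hJQ, he.2.1.2.trans hle⟩, ?_⟩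
      · intro S f hf
        -- Above this threshold a nice `R₁` has order at least `|N_N(X J)| > |N_N(R)|`, so `R₁ > X`
        -- and its normalizer is already covered by `hm`.
        refine hE.alperin hH hN (Nat.card (normalizerIn N (X ⊔ J))) ?_ hf le_rfl
        intro R₁ hXR₁ hR₁N hk hnice _
        have : Finite (normalizerIn N R₁) := hE.finite_of_le inf_le_left
        have h1 : Nat.card R₁ ≤ Nat.card (normalizerIn N R₁) :=
          Subgroup.card_le_of_le (le_normalizerIn_self hR₁N)
        refine haut_of hXR₁ hR₁N (hm R₁ (hlt_of_card hXR₁ (by omega)) hR₁N hnice ?_)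
        omega
      · intro Y' hXY' hY'N hcY hn hnice
        refine hm Y' (hlt_of_card hXY' ?_) hY'N hnice (by omega)
        rw [hcY]
        exact card_lt_of_lt hXY
      · have h1 : X ⊔ J ≤ preimage e (X ⊔ J) := by
          refine sup_le (fun x hx => ⟨hXQ hx, le_sup_left (b := J) (hE.pres he.1 x hx)⟩)
            fun x hx => ⟨hJQ hx, le_sup_right (a := X) ?_⟩
          exact app_mem_thompson e hJQ he.2.2.1.2 x hx
        exact ⟨⟨le_cod_of_app e (sup_le hXQ hJQ) fun x hx => (h1 hx).2,
          he.2.2.1.2.trans hle⟩, fun x hx => (h1 hx).2⟩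
  intro Q S e he
  refine hE.alperin hH hN 0 ?_ he (Nat.zero_le _)
  intro R hXR hRN _ hR hbig α hα
  rcases hXR.eq_or_lt with rfl | hlt
  · have hc : ∀ z ∈ Z, ∀ x ∈ X, z * x * z⁻¹ ∈ X := fun z hz x hx => by
      rw [← hZ x (hRN hx) z hz]; simpa using hx
    have hmem : ∀ {x : G}, x ∈ X ⊔ Z ↔ ∃ y ∈ X, ∃ b ∈ Z, x = y * b :=
      mem_sup_iff_of_normalizes hc
    -- `Z` centralizes `X`, so conjugation by `y b` with `b` in `Z` agrees on `X` with conjugation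
    -- by `y`; its transport is conjugation by `α(y)`.
    obtain ⟨T', f, hf, hres⟩ := hR.ext hα (T := X ⊔ Z) (sup_le hRN hZN) le_sup_left
      (fun x hx z hz => hE.norm x (sup_le hRN hZN hx) z hz) (by
        intro x hx
        obtain ⟨y, hy, b, hb, rfl⟩ := hmem.1 hx
        refine ⟨app α y, hRN (app_mem α hy), fun z hz => ?_⟩
        have h1 : y * b * z * (y * b)⁻¹ = y * z * y⁻¹ := by
          calc _ = y * (b * z) * b⁻¹ * y⁻¹ := by group
            _ = _ := by rw [← hZ z (hRN hz) b hb]; group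
        rw [h1, app_conj α hy hz])
    have : Finite ↥(X ⊔ Z) := hE.finite_of_le (sup_le hRN hZN)
    exact hH.res (hbig hf (card_lt_of_lt hXZ)) hres
  · exact haut_of hXR hRN (hclaim (Nat.card N + 1) R hlt hRN hR (by omega)) α hα

end IsLocalSystem

end NotLe

/-! ### Invariant central subgroups and the Frattini reduction -/

section Hull

variable {G : Type*} [Group G] {p : ℕ} {X N Q R S Z V W : Subgroup G} {E H : IsoFamily G}

theorem mem_mho_iff (hV : IsMulCommutative V) {w : G} : w ∈ mho p 1 V ↔ ∃ v ∈ V, w = v ^ p := by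
  have hc := isMulCommutative_iff.1 hV
  constructor
  · intro h
    refine Subgroup.closure_induction (fun x hx => ?_) ?_ ?_ ?_ h
    · obtain ⟨v, hv, rfl⟩ := hx
      exact ⟨v, hv, by rw [pow_one]⟩
    · exact ⟨1, one_mem _, (one_pow _).symm⟩
    · rintro _ _ _ _ ⟨v, hv, rfl⟩ ⟨w, hw, rfl⟩
      exact ⟨v * w, mul_mem hv hw, (Commute.mul_pow (hc v hv w hw) p).symm⟩
    · rintro _ _ ⟨v, hv, rfl⟩
      exact ⟨v⁻¹, inv_mem hv, (inv_pow v p).symm⟩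
  · rintro ⟨v, hv, rfl⟩
    exact Subgroup.subset_closure ⟨v, hv, by rw [pow_one]⟩

/-- The subgroup generated by the images of `Z` under the automorphisms of `X` in `E`. -/
def hull (E : IsoFamily G) (X Z : Subgroup G) : Subgroup G :=
  Subgroup.closure {y | ∃ α ∈ E X X, ∃ z ∈ Z, y = app α z}

/-- `V` is central in `X` and invariant under `E`. -/
structure IsInvariantCentral (X : Subgroup G) (E : IsoFamily G) (V : Subgroup G) : Prop where
  le : V ≤ X
  central : ∀ x ∈ X, ∀ v ∈ V, x * v = v * x
  app_mem : ∀ {Q S : Subgroup G} {e : Q ≃* S}, e ∈ E Q S → ∀ v ∈ V, app e v ∈ V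

theorem IsInvariantCentral.isMulCommutative (hV : IsInvariantCentral X E V) :
    IsMulCommutative V :=
  isMulCommutative_iff.2 fun x hx y hy => hV.central x (hV.le hx) y hy

theorem IsInvariantCentral.mho (hE : IsLocalSystem p X N E) (hV : IsInvariantCentral X E V) :
    IsInvariantCentral X E (mho p 1 V) := by
  have h := fun {w} => mem_mho_iff (p := p) hV.isMulCommutative (w := w)
  refine ⟨fun w hw => ?_, fun x hx w hw => ?_, fun {Q S e} he w hw => ?_⟩ <;>
    obtain ⟨v, hv, rfl⟩ := h.1 hw
  · exact pow_mem (hV.le hv) p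
  · exact Commute.pow_right (hV.central x hx v hv) p
  · rw [app_pow e ((hE.dom he).1 (hV.le hv))]
    exact h.2 ⟨_, hV.app_mem he v hv, rfl⟩

namespace IsLocalSystem

theorem exists_res_aut (hE : IsLocalSystem p X N E) {e : Q ≃* S} (he : e ∈ E Q S) :
    ∃ α : MulAut X, α ∈ E X X ∧ IsRes α e := by
  have := hE.finite_of_le hE.le
  obtain ⟨α, hα⟩ := exists_res_eq e (hE.dom he).1 (hE.pres he) le_rfl
  exact ⟨α, hE.res he hα le_rfl, hα⟩

theorem exists_conj_aut (hE : IsLocalSystem p X N E) {n : G} (hn : n ∈ N) :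
    ∃ α : MulAut X, α ∈ E X X ∧ ∀ x ∈ X, app α x = n * x * n⁻¹ := by
  have := hE.finite_of_le hE.le
  obtain ⟨α, hα⟩ := exists_conj_eq (hE.norm n hn)
  exact ⟨α, hE.conj hn le_rfl hE.le hα, hα⟩

theorem le_hull (hE : IsLocalSystem p X N E) (hZX : Z ≤ X) : Z ≤ hull E X Z := fun z hz =>
  Subgroup.subset_closure ⟨_, hE.refl le_rfl hE.le, z, hz, (app_refl (hZX hz)).symm⟩

theorem isInvariantCentral_hull (hE : IsLocalSystem p X N E) (hZX : Z ≤ X)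
    (hZ : ∀ n ∈ N, ∀ z ∈ Z, n * z = z * n) : IsInvariantCentral X E (hull E X Z) := by
  have hle : hull E X Z ≤ X := by
    rw [hull, Subgroup.closure_le]
    rintro _ ⟨α, -, z, hz, rfl⟩
    exact app_mem α (hZX hz)
  refine ⟨hle, fun x hx v hv => ?_, fun {Q S e} he v hv => ?_⟩
  · have h : hull E X Z ≤ Subgroup.centralizer {x} := by
      rw [hull, Subgroup.closure_le]
      rintro _ ⟨α, -, z, hz, rfl⟩
      refine Subgroup.mem_centralizer_iff.2 ?_
      rintro _ rfl
      have hy := app_mem (MulEquiv.symm α) hx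
      rw [← app_app_symm α hx, ← app_mul α hy (hZX hz), hZ _ (hE.le hy) z hz,
        app_mul α (hZX hz) hy]
    exact Subgroup.mem_centralizer_iff.1 (h hv) x rfl
  · obtain ⟨β, hβ, hres⟩ := hE.exists_res_aut he
    have h : hull E X Z ≤ preimage e (hull E X Z) := by
      conv_lhs => rw [hull]
      rw [Subgroup.closure_le]
      rintro _ ⟨α, hα, z, hz, rfl⟩
      refine ⟨hres.1 (app_mem α (hZX hz)), Subgroup.subset_closure
        ⟨α.trans β, hE.trans hα hβ, z, hz, ?_⟩⟩
      rw [app_trans _ _ (hZX hz), hres.2 _ (app_mem α (hZX hz))]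
    exact (h hv).2

theorem conj_mem_of_isInvariantCentral (hE : IsLocalSystem p X N E)
    (hV : IsInvariantCentral X E V) : ∀ n ∈ N, ∀ v ∈ V, n * v * n⁻¹ ∈ V := by
  intro n hn v hv
  obtain ⟨α, hα, h⟩ := hE.exists_conj_aut hn
  rw [← h v (hV.le hv)]
  exact hV.app_mem hα v hv

/-- The generation theorem when the centralizer of an invariant central subgroup `W` is larger
than `X`. -/
theorem subset_of_centralizer [Fact p.Prime] (hE : IsLocalSystem p X N E) (hH : IsClosedFamily H)
    (hW : IsInvariantCentral X E W)
    (hN : ∀ {S : Subgroup G} {e : N ≃* S}, e ∈ E N S → e ∈ H N S)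
    (hcent : ∀ {Q S : Subgroup G} {e : Q ≃* S}, e ∈ E Q S → (∀ w ∈ W, app e w = w) → e ∈ H Q S)
    (hnorm : ∀ R : Subgroup G, X < R → R ≤ N → Nice p N E R → normalizerIn N R = N →
      ∀ {Q S : Subgroup G} {e : Q ≃* S}, e ∈ FusionSystem.normFamily N R E Q S → e ∈ H Q S)
    (hX : X ≠ N ⊓ Subgroup.centralizer W) :
    ∀ {Q S : Subgroup G} {e : Q ≃* S}, e ∈ E Q S → e ∈ H Q S := by
  have := hE.finite
  set D := N ⊓ Subgroup.centralizer (W : Set G) with hD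
  have hmemD : ∀ {x : G}, x ∈ D ↔ x ∈ N ∧ ∀ w ∈ W, w * x = x * w :=
    and_congr_right fun _ => Subgroup.mem_centralizer_iff
  have hWX := hW.le
  have hXD : X < D := lt_of_le_of_ne (fun x hx => hmemD.2
    ⟨hE.le hx, fun w hw => (hW.central x hx w hw).symm⟩) hX
  have hDN : D ≤ N := inf_le_left
  have := hE.finite_of_le hDN
  have hDnorm : normalizerIn N D = N := by
    refine le_antisymm inf_le_left fun n hn => mem_normalizerIn_iff.2 ⟨hn, fun d hd => ?_⟩
    refine hmemD.2 ⟨mul_mem (mul_mem hn (hDN hd)) (inv_mem hn), fun w hw => ?_⟩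
    have h1 := hE.conj_mem_of_isInvariantCentral hW _ (inv_mem hn) w hw
    calc w * (n * d * n⁻¹) = n * ((n⁻¹ * w * n⁻¹⁻¹) * d) * n⁻¹ := by group
      _ = _ := by rw [(hmemD.1 hd).2 _ h1]; group
  have hND : ∀ {Q S : Subgroup G} {e : Q ≃* S},
      e ∈ FusionSystem.normFamily N D E Q S → e ∈ H Q S := by
    -- A nice conjugate of `D` has a normalizer of order at least `|N_N(D)| = |N|`, so it is normal
    -- in `N` and `hnorm` applies.
    refine hE.normFamily_subset_of_conj hH hXD.le hDN ?_ ?_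
    · rw [hDnorm]; exact hN
    · intro Y hXY hYN hc hn hY
      refine hnorm Y (lt_of_le_of_ne hXY ?_) hYN hY (hE.normalizerIn_eq (by rwa [hDnorm] at hn))
      rintro rfl
      have := card_lt_of_lt hXD
      omega
  intro Q S e he
  refine hE.alperin hH hN 0 ?_ he (Nat.zero_le _)
  intro R hXR hRN _ hR hbig α hα
  have := hE.finite_of_le hRN
  by_cases hDR : D ≤ R
  · have h1 : ∀ x ∈ D, app α x ∈ D := by
      intro x hx
      refine hmemD.2 ⟨hRN (app_mem α (hDR hx)), fun w hw => ?_⟩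
      have hw' := hW.app_mem (hE.symm hα) w hw
      rw [← app_app_symm α (hXR (hWX hw)), ← app_mul α (hXR (hWX hw')) (hDR hx),
        (hmemD.1 hx).2 _ hw', app_mul α (hDR hx) (hXR (hWX hw'))]
    have h2 : D ≤ R ∧ R ≤ normalizerIn N D := ⟨hDR, by rwa [hDnorm]⟩
    exact hND ⟨hα, h2, h2, h1⟩
  let C : Subgroup (MulAut R) :=
    { carrier := {β | β ∈ E R R ∧ ∀ w ∈ W, app β w = w}
      one_mem' := ⟨hE.refl hXR hRN, fun w hw => app_one_aut (hXR (hWX hw))⟩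
      mul_mem' := fun {a b} ha hb => ⟨hE.trans hb.1 ha.1, fun w hw => by
        rw [app_mul_aut _ _ (hXR (hWX hw)), hb.2 w hw, ha.2 w hw]⟩
      inv_mem' := fun {a} ha => ⟨hE.symm ha.1, fun w hw => by
        conv_lhs => rw [← ha.2 w hw]
        exact app_inv_aut_app a (hXR (hWX hw))⟩ }
  -- Frattini: modulo the normal subgroup `C` of automorphisms fixing `W`, `α` may be taken to
  -- normalize `conjAut N R ⊓ C`. The correction `c` lies in `H` by `hcent`.
  obtain ⟨c, hc, hcα⟩ := exists_mul_conjInto (p := p) (A := hE.aut hXR hRN) (S := conjAut N R)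
    (C := C) (isPGroup_conjAut hE.isPGroup R)
    (fun β hβ => hβ.1) (fun T hT hTA => hR.full T hT hTA)
    (fun β hβ γ hγ => ⟨mul_mem (mul_mem hβ hγ.1 : β * γ ∈ hE.aut hXR hRN) (inv_mem hβ),
      fun w hw => by
        have h1 := hXR (hWX hw)
        have h2 := hW.app_mem (hE.symm hβ) w hw
        rw [app_mul_aut _ _ h1, app_mul_aut _ _ (app_mem _ h1)]
        change app β (app γ (app (MulEquiv.symm β) w)) = w
        rw [hγ.2 _ h2]
        exact app_app_symm β h1⟩) hα
  have hcαE : c * α ∈ E R R := hE.trans hα hc.1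
  have hRD : R < R ⊔ D := lt_of_le_of_ne le_sup_left fun h => hDR (by rw [h]; exact le_sup_right)
  have hRDN : R ⊔ D ≤ N := sup_le hRN hDN
  have := hE.finite_of_le hRDN
  -- An element of `R D` outside `R` that normalizes `R` has its `D`-component in `N_N(R)` and
  -- outside `R`; hence `D ⊓ N_N(R)` is not contained in `R`.
  obtain ⟨k, hk, hkR, hkn⟩ := exists_normalizing (hE.isPGroup.to_le hRDN) hRD
  have hnormal : ∀ b ∈ R, ∀ d ∈ D, b * d * b⁻¹ ∈ D := fun b hb =>
    (mem_normalizerIn_iff.1 (hDnorm.ge (hRN hb))).2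
  rw [sup_comm] at hk
  obtain ⟨d, hd, r, hr, rfl⟩ := (mem_sup_iff_of_normalizes hnormal).1 hk
  have hdR : d ∉ R := fun h => hkR (mul_mem h hr)
  have hdn : d ∈ normalizerIn N R := mem_normalizerIn_iff.2 ⟨hDN hd, fun x hx => by
    have := hkn (r⁻¹ * x * r) (mul_mem (mul_mem (inv_mem hr) hx) hr)
    convert this using 1
    group⟩
  have hRnorm : ∀ b ∈ D ⊓ normalizerIn N R, ∀ x ∈ R, b * x * b⁻¹ ∈ R := fun b hb =>
    (mem_normalizerIn_iff.1 hb.2).2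
  have hTN : R ⊔ (D ⊓ normalizerIn N R) ≤ normalizerIn N R :=
    sup_le (le_normalizerIn_self hRN) inf_le_right
  -- Conjugations of `R` by `D ⊓ N_N(R)` lie in `conjAut N R ⊓ C`, which `c * α` normalizes, so `c *
  -- α` extends to a strictly larger subgroup.
  obtain ⟨T', f, hf, hres⟩ := hR.ext hcαE (T := R ⊔ (D ⊓ normalizerIn N R))
    (hTN.trans inf_le_left) le_sup_left
    (fun x hx => (mem_normalizerIn_iff.1 (hTN hx)).2) (by
      intro x hx
      obtain ⟨y, hy, b, hb, rfl⟩ := (mem_sup_iff_of_normalizes hRnorm).1 hx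
      obtain ⟨γ, hγ⟩ := exists_conj_eq (hRnorm b hb)
      have hγS : γ ∈ conjAut N R ⊓ C := by
        refine ⟨⟨b, hDN hb.1, hγ⟩, hE.conj (hDN hb.1) hXR hRN hγ, fun w hw => ?_⟩
        rw [hγ w (hXR (hWX hw)), ← (hmemD.1 hb.1).2 w hw]
        group
      obtain ⟨⟨n, hn, hγn⟩, -⟩ := hcα γ hγS
      refine ⟨app (c * α) y * n, mul_mem (hRN (app_mem _ hy)) hn, fun z hz => ?_⟩
      have hbz := hRnorm b hb z hz
      have h1 := hγn _ (app_mem (c * α) hz)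
      rw [app_mul_aut _ _ (app_mem _ hz), app_inv_aut_app _ hz, app_mul_aut _ _ hz, hγ z hz] at h1
      have h2 : y * b * z * (y * b)⁻¹ = y * (b * z * b⁻¹) * y⁻¹ := by group
      rw [h2, app_conj _ hy hbz, h1]
      group)
  have hfin : Finite ↥(R ⊔ (D ⊓ normalizerIn N R)) := hE.finite_of_le (hTN.trans inf_le_left)
  have hlt : R < R ⊔ (D ⊓ normalizerIn N R) := lt_of_le_of_ne le_sup_left fun h => hdR (by
    rw [h]; exact le_sup_right (a := R) ⟨hd, hdn⟩)
  have h1 : c * α ∈ H R R := hH.res (hbig hf (card_lt_of_lt hlt)) hres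
  have h2 : c ∈ H R R := hcent hc.1 hc.2
  have h3 : c⁻¹ * (c * α) ∈ H R R := hH.trans h1 (hH.symm h2)
  rwa [inv_mul_cancel_left] at h3

end IsLocalSystem

end Hull

/-! ### Quadratic action, and the induction for local systems -/

section Quadratic

variable {G : Type*} [Group G] {p : ℕ} {X N Q R S Z V W : Subgroup G} {E H : IsoFamily G}

theorem commutator_pow_right {V : Subgroup G} (hV : IsMulCommutative V) {a v : G}
    (ha : ∀ v ∈ V, a * v * a⁻¹ ∈ V) (hv : v ∈ V) (k : ℕ) :
    a * v ^ k * a⁻¹ * (v ^ k)⁻¹ = (a * v * a⁻¹ * v⁻¹) ^ k := by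
  have h : Commute (a * v * a⁻¹) v⁻¹ :=
    isMulCommutative_iff.1 hV _ (ha v hv) _ (inv_mem hv)
  rw [h.mul_pow, conj_pow, inv_pow]

theorem commutator_pow_left {a v : G}
    (h : a * (a * v * a⁻¹ * v⁻¹) = (a * v * a⁻¹ * v⁻¹) * a) (k : ℕ) :
    a ^ k * v * (a ^ k)⁻¹ * v⁻¹ = (a * v * a⁻¹ * v⁻¹) ^ k := by
  induction k with
  | zero => simp
  | succ k ih =>
    have h1 : a * (a * v * a⁻¹ * v⁻¹) ^ k = (a * v * a⁻¹ * v⁻¹) ^ k * a :=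
      Commute.pow_right h k
    calc a ^ (k + 1) * v * (a ^ (k + 1))⁻¹ * v⁻¹
        = a * (a ^ k * v * (a ^ k)⁻¹ * v⁻¹) * v * a⁻¹ * v⁻¹ := by rw [pow_succ']; group
      _ = (a * v * a⁻¹ * v⁻¹) ^ k * (a * v * a⁻¹ * v⁻¹) := by rw [ih, h1]; group
      _ = _ := (pow_succ _ _).symm

namespace IsLocalSystem

/-- Every member of `E` preserves `X`, so the nice conjugate of `X` can only be `X` itself. -/
theorem nice_self (hE : IsLocalSystem p X N E) : Nice p N E X := by
  obtain ⟨R, e, he, hR⟩ := hE.nice le_rfl hE.le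
  have := hE.finite_of_le hE.le
  obtain rfl := cod_eq_of_app e (Q := X) (hE.pres he) le_rfl
  exact hR

/-- An element of `N` that acts trivially on `V / ℧¹(V)` and on `℧¹(V)`, where `V` is the hull
of a central subgroup, centralizes `V`. -/
theorem commute_hull [Fact p.Prime] (hE : IsLocalSystem p X N E) (hZX : Z ≤ X)
    (hZ : ∀ n ∈ N, ∀ z ∈ Z, n * z = z * n) {b : G} (hb : b ∈ N)
    (hb₁ : ∀ v ∈ hull E X Z, b * v * b⁻¹ * v⁻¹ ∈ mho p 1 (hull E X Z))
    (hb₂ : ∀ w ∈ mho p 1 (hull E X Z), b * w = w * b) :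
    ∀ v ∈ hull E X Z, b * v = v * b := by
  have := hE.finite_of_le hE.le
  have hV := hE.isInvariantCentral_hull hZX hZ
  have hW := hV.mho (p := p) hE
  have hZV := hE.le_hull hZX
  have hmem := fun {w} => mem_mho_iff (p := p) hV.isMulCommutative (w := w)
  set V := hull E X Z with hVdef
  set W := mho p 1 V with hWdef
  have hWV : W ≤ V := fun w hw => by
    obtain ⟨v, hv, rfl⟩ := hmem.1 hw
    exact pow_mem hv p
  have hVX := hV.le
  let K : Subgroup (MulAut X) :=
    { carrier := {α | α ∈ E X X ∧ (∀ v ∈ V, ∃ w ∈ W, app α v = w * v) ∧ ∀ w ∈ W, app α w = w}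
      one_mem' := ⟨hE.refl le_rfl hE.le, fun v hv => ⟨1, one_mem _, by
        rw [app_one_aut (hVX hv), one_mul]⟩, fun w hw => app_one_aut (hW.le hw)⟩
      mul_mem' := fun {α β} ha hb => by
        refine ⟨hE.trans hb.1 ha.1, fun v hv => ?_, fun w hw => ?_⟩
        · obtain ⟨w, hw, h⟩ := hb.2.1 v hv
          obtain ⟨w', hw', h'⟩ := ha.2.1 v hv
          refine ⟨w * w', mul_mem hw hw', ?_⟩
          rw [app_mul_aut _ _ (hVX hv), h, app_mul _ (hW.le hw) (hVX hv), ha.2.2 w hw, h',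
            mul_assoc]
        · rw [app_mul_aut _ _ (hW.le hw), hb.2.2 w hw, ha.2.2 w hw]
      inv_mem' := fun {α} ha => by
        have h1 : ∀ w ∈ W, app α⁻¹ w = w := fun w hw => by
          conv_lhs => rw [← ha.2.2 w hw]
          exact app_inv_aut_app α (hW.le hw)
        refine ⟨hE.symm ha.1, fun v hv => ?_, h1⟩
        have h2 : app α⁻¹ v ∈ V := hV.app_mem (hE.symm ha.1) v hv
        obtain ⟨w, hw, h⟩ := ha.2.1 _ h2
        rw [app_app_inv_aut α (hVX hv)] at h
        exact ⟨w⁻¹, inv_mem hw, by rw [h]; rw [← h]; rw [eq_inv_mul_iff_mul_eq]; exact h.symm⟩ }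
  let D : Subgroup (MulAut X) :=
    { carrier := {α | α ∈ E X X ∧ ∀ v ∈ V, app α v = v}
      one_mem' := ⟨hE.refl le_rfl hE.le, fun v hv => app_one_aut (hVX hv)⟩
      mul_mem' := fun {α β} ha hb => ⟨hE.trans hb.1 ha.1, fun v hv => by
        rw [app_mul_aut _ _ (hVX hv), hb.2 v hv, ha.2 v hv]⟩
      inv_mem' := fun {α} ha => ⟨hE.symm ha.1, fun v hv => by
        conv_lhs => rw [← ha.2 v hv]
        exact app_inv_aut_app α (hVX hv)⟩ }
  have hconjE : ∀ α β : MulAut X, α ∈ E X X → β ∈ E X X → α * β * α⁻¹ ∈ E X X := fun α β ha hb =>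
    hE.trans (hE.symm ha) (hE.trans hb ha)
  have hconj : ∀ (α β : MulAut X) (v : G), v ∈ X →
      app (α * β * α⁻¹) v = app α (app β (app α⁻¹ v)) := fun α β v hv => by
    rw [app_mul_aut _ _ hv, app_mul_aut _ _ (app_mem _ hv)]
  have hinvV : ∀ α : MulAut X, α ∈ E X X → ∀ v ∈ V, app α⁻¹ v ∈ V := fun α ha v hv =>
    hV.app_mem (hE.symm ha) v hv
  have hinvW : ∀ α : MulAut X, α ∈ E X X → ∀ v ∈ W, app α⁻¹ v ∈ W := fun α ha v hv =>
    hW.app_mem (hE.symm ha) v hv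
  have hKnorm : ∀ α : MulAut X, α ∈ E X X → ConjInto α K K := by
    intro α ha β hβ
    refine ⟨hconjE α β ha hβ.1, fun v hv => ?_, fun w hw => ?_⟩
    · have hv' := hinvV α ha v hv
      obtain ⟨w, hw, h⟩ := hβ.2.1 _ hv'
      refine ⟨app α w, hW.app_mem ha w hw, ?_⟩
      rw [hconj _ _ _ (hVX hv), h, app_mul _ (hW.le hw) (hVX hv'), app_app_inv_aut α (hVX hv)]
    · rw [hconj _ _ _ (hW.le hw), hβ.2.2 _ (hinvW α ha w hw), app_app_inv_aut α (hW.le hw)]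
  have hKZ : ∀ α ∈ K, ∀ z ∈ Z, app α z = z := by
    intro α hα z hz
    -- `K / D` has exponent dividing `p`, so `K` is covered by `D` and the conjugations in `K`
    -- coming from `N`. The latter fix `Z` because it is central in `N`, the former because `Z ≤ V`.
    obtain ⟨s, hs, d, hd, rfl⟩ := exists_mul_of_pow_mem (p := p) (A := hE.aut le_rfl hE.le)
      (S := conjAut N X) (C := K) (D := D) (isPGroup_conjAut hE.isPGroup X) (fun β hβ => hβ.1)
      (fun T hT hTA => hE.nice_self.full T hT hTA) (fun β hβ => hKnorm β hβ)
      (fun β hβ γ hγ => ⟨hconjE β γ hβ.1 hγ.1, fun v hv => by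
        rw [hconj _ _ _ (hVX hv), hγ.2 _ (hinvV β hβ.1 v hv), app_app_inv_aut β (hVX hv)]⟩)
      (fun β hβ => ⟨(pow_mem (show β ∈ hE.aut le_rfl hE.le from hβ.1) p : _), fun v hv => by
        obtain ⟨w, hw, h⟩ := hβ.2.1 v hv
        have h1 : ∀ k : ℕ, app (β ^ k) v = w ^ k * v := by
          intro k
          induction k with
          | zero => rw [pow_zero, app_one_aut (hVX hv), pow_zero, one_mul]
          | succ k ih =>
            rw [pow_succ', app_mul_aut _ _ (hVX hv), ih,
              app_mul _ (pow_mem (hW.le hw) k) (hVX hv), app_pow _ (hW.le hw), hβ.2.2 w hw, h,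
              pow_succ, mul_assoc]
        -- `β` sends `v` to `w v` and fixes `v ^ p`, which lies in `W`; hence `w ^ p = 1`, and `β ^
        -- p` fixes `v`.
        have h2 : (w * v) ^ p = v ^ p := by
          rw [← h, ← app_pow β (hVX hv)]
          exact hβ.2.2 _ (hmem.2 ⟨v, hv, rfl⟩)
        have h3 : Commute w v := hV.central w (hW.le hw) v hv
        rw [h3.mul_pow, mul_eq_right] at h2
        rw [h1, h2, one_mul]⟩) hα
    rw [app_mul_aut _ _ (hZX hz), hd.2 z (hZV hz)]
    obtain ⟨⟨n, hn, h⟩, -⟩ := hs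
    rw [h z (hZX hz), hZ n hn z hz]
    group
  have hKV : ∀ α ∈ K, ∀ v ∈ V, app α v = v := by
    intro α hα v hv
    -- `K` is normal in Aut_E(X) and fixes `Z`, so it fixes every image of `Z`, and these generate
    -- `V`.
    have h : V ≤ fixedBy (Q := X) α := by
      rw [hVdef, hull, Subgroup.closure_le]
      rintro _ ⟨β, hβ, z, hz, rfl⟩
      refine ⟨app_mem β (hZX hz), ?_⟩
      have h1 := hKZ _ (hKnorm (β⁻¹ : MulAut X) (hE.symm hβ) α hα) z hz
      rw [hconj _ _ _ (hZX hz), inv_inv] at h1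
      have h2 := app_app_inv_aut (β : MulAut X) (app_mem α (app_mem β (hZX hz)))
      rw [← h2, h1]
    exact (h hv).2
  obtain ⟨α, hα, h⟩ := hE.exists_conj_aut hb
  have hαK : α ∈ K := by
    refine ⟨hα, fun v hv => ⟨_, hb₁ v hv, ?_⟩, fun w hw => ?_⟩
    · rw [h v (hVX hv)]; group
    · rw [h w (hW.le hw), hb₂ w hw]; group
  intro v hv
  have h1 := hKV α hαK v hv
  rw [h v (hVX hv)] at h1
  exact mul_inv_eq_iff_eq_mul.1 h1

/-- If `℧¹` of the hull of a central subgroup has centralizer `X`, then `X` contains `J(N)`. -/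
theorem thompson_le_of_centralizer [Fact p.Prime] (hE : IsLocalSystem p X N E) (hZX : Z ≤ X)
    (hZ : ∀ n ∈ N, ∀ z ∈ Z, n * z = z * n)
    (hX : X = N ⊓ Subgroup.centralizer (mho p 1 (hull E X Z))) : thompson N ≤ X := by
  have := hE.finite
  have hV := hE.isInvariantCentral_hull hZX hZ
  have hmem := fun {w} => mem_mho_iff (p := p) hV.isMulCommutative (w := w)
  have hcomm := @commute_hull _ _ p X N Z E _ hE hZX hZ
  set V := hull E X Z with hVdef
  have hVN := hE.conj_mem_of_isInvariantCentral hV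
  by_contra hJ
  have hex : ∃ A, IsMaxAbelian N A ∧ ¬ A ≤ Subgroup.centralizer V := by
    by_contra hno
    push Not at hno
    refine hJ (sSup_le fun A hA => ?_)
    rw [hX]
    refine le_inf hA.1 fun a ha => Subgroup.mem_centralizer_iff.2 fun w hw => ?_
    obtain ⟨v, hv, rfl⟩ := hmem.1 hw
    exact Commute.pow_left (Subgroup.mem_centralizer_iff.1 (hno A hA ha) v hv) p
  obtain ⟨A, hA, hAV, hquad⟩ := exists_quadratic hE.isPGroup (hV.le.trans hE.le)
    hV.isMulCommutative hVN hex
  refine hAV fun a ha => Subgroup.mem_centralizer_iff.2 fun v hv => ?_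
  have haN := hA.1 ha
  have hright := fun {v} (hv : v ∈ V) (k : ℕ) {b : G} (hb : b ∈ N) =>
    commutator_pow_right hV.isMulCommutative (fun v hv => hVN b hb v hv) hv k
  have hleft := fun {v} (hv : v ∈ V) (k : ℕ) => commutator_pow_left (hquad v hv a ha a ha) k
  have hcom_iff : ∀ x y : G, x * y * x⁻¹ * y⁻¹ = 1 ↔ x * y = y * x := fun x y => by
    rw [mul_inv_eq_one, mul_inv_eq_iff_eq_mul]
  -- `[a^(p^(j+1)), v]` is a `p`-th power, so the action on `V / ℧¹(V)` is trivial; on `℧¹(V)` it is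
  -- trivial since `[a^(p^(j+1)), v^p] = [a^(p^(j+2)), v]`. The descent stops at `a ^ p`, because
  -- `[a, v]` itself need not be a `p`-th power.
  have hstep : ∀ j : ℕ, (∀ v ∈ V, a ^ p ^ (j + 2) * v = v * a ^ p ^ (j + 2)) →
      ∀ v ∈ V, a ^ p ^ (j + 1) * v = v * a ^ p ^ (j + 1) := by
    intro j hj
    refine hcomm (pow_mem haN _) (fun v hv => ?_) (fun w hw => ?_)
    · rw [hleft hv, pow_succ, pow_mul]
      refine hmem.2 ⟨_, pow_mem (mul_mem (hVN a haN v hv) (inv_mem hv)) _, rfl⟩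
    · obtain ⟨v, hv, rfl⟩ := hmem.1 hw
      rw [← hcom_iff, hleft (pow_mem hv p), hright hv p haN, ← pow_mul, ← pow_succ', ← hleft hv,
        hcom_iff]
      exact hj v hv
  have hpow : ∀ v ∈ V, a ^ p ^ 1 * v = v * a ^ p ^ 1 := by
    obtain ⟨k, hk⟩ := hE.isPGroup ⟨a, haN⟩
    have hk' : a ^ p ^ k = 1 := congrArg Subtype.val hk
    have h0 : ∀ v ∈ V, a ^ p ^ (k + 1) * v = v * a ^ p ^ (k + 1) := fun v _ => by
      rw [pow_succ, pow_mul, hk', one_pow, one_mul, mul_one]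
    clear hk hk'
    induction k with
    | zero => exact h0
    | succ k ih => exact ih (hstep k h0)
  -- `[a, v^p] = [a^p, v] = 1`, so `a` centralizes `℧¹(V)`.
  have haX : a ∈ X := by
    rw [hX]
    refine ⟨haN, Subgroup.mem_centralizer_iff.2 fun w hw => ?_⟩
    obtain ⟨v, hv, rfl⟩ := hmem.1 hw
    refine ((hcom_iff a _).1 ?_).symm
    rw [hright hv p haN, ← hleft hv, hcom_iff]
    simpa using hpow v hv
  exact (hV.central a haX v hv).symm

/-- The generation theorem for saturated systems. -/
theorem subset_of_generators [Fact p.Prime] (n : ℕ) :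
    ∀ {X N Z : Subgroup G} {E H : IsoFamily G}, IsLocalSystem p X N E →
      Nat.card N ≤ n + Nat.card X → IsClosedFamily H → Z ≤ N →
      (∀ n ∈ N, ∀ z ∈ Z, n * z = z * n) →
      (∀ {Q S : Subgroup G} {e : Q ≃* S}, e ∈ E Q S → Z ≤ Q →
        (∀ z ∈ Z, app e (z ^ p) = z ^ p) → e ∈ H Q S) →
      (∀ {Q S : Subgroup G} {e : Q ≃* S}, e ∈ E Q S → thompson N ≤ Q → e ∈ H Q S) →
      ∀ {Q S : Subgroup G} {e : Q ≃* S}, e ∈ E Q S → e ∈ H Q S := by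
  induction n with
  | zero =>
    intro X N Z E H hE hc hH hZN hZ hcent hthompson Q S e he
    have := hE.finite
    have h1 := eq_of_le_of_card hE.le (by omega)
    exact hthompson he ((thompson_le N).trans (h1 ▸ (hE.dom he).1))
  | succ n ih =>
    intro X N Z E H hE hc hH hZN hZ hcent hthompson
    have := hE.finite
    have hIH : ∀ R : Subgroup G, X < R → R ≤ N → Nice p N E R →
        (∀ {Q S : Subgroup G} {e : Q ≃* S}, e ∈ FusionSystem.normFamily N R E Q S →
          thompson (normalizerIn N R) ≤ Q → e ∈ H Q S) →
        ∀ {Q S : Subgroup G} {e : Q ≃* S}, e ∈ FusionSystem.normFamily N R E Q S →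
          e ∈ H Q S := by
      intro R hXR hRN hR h Q S e he
      have := hE.finite_of_le hRN
      have h1 := card_lt_of_lt hXR
      have h2 : Nat.card (normalizerIn N R) ≤ Nat.card N := Subgroup.card_le_of_le inf_le_left
      have hZR : Z ≤ normalizerIn N R := fun z hz => mem_normalizerIn_iff.2 ⟨hZN hz,
        fun x hx => by rw [← hZ x (hRN hx) z hz]; simpa using hx⟩
      -- Passing to the normalizer of `R` replaces `|N| - |X|` by `|N_N(R)| - |R|`, which is smaller
      -- since `R > X`; `Z` remains central.
      exact ih (hE.normFamily hXR.le hRN hR) (by omega) hH hZR (fun n hn => hZ n hn.1)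
        (fun he hZQ hz => hcent he.1 hZQ hz) h he
    intro Q S e he
    by_cases hZX : Z ≤ X
    · by_cases hX : X = N ⊓ Subgroup.centralizer (mho p 1 (hull E X Z))
      · exact hthompson he ((hE.thompson_le_of_centralizer hZX hZ hX).trans (hE.dom he).1)
      · have hV := hE.isInvariantCentral_hull hZX hZ
        refine hE.subset_of_centralizer hH (hV.mho (p := p) hE)
          (fun he => hthompson he (thompson_le N)) (fun he hw => ?_) ?_ hX he
        · refine hcent he (hZX.trans (hE.dom he).1) fun z hz => hw _ ?_
          exact (mem_mho_iff hV.isMulCommutative).2 ⟨z, hE.le_hull hZX hz, rfl⟩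
        · intro R hXR hRN hR hRn Q S e he
          refine hIH R hXR hRN hR (fun he hJ => hthompson he.1 ?_) he
          rwa [hRn] at hJ
    · exact hE.subset_of_not_le hH hZN hZ hZX hthompson hIH he

end IsLocalSystem

end Quadratic

/-! ### Saturated fusion systems are local systems -/

section Saturated

variable {G : Type*} [Group G] {p : ℕ} {P Q R S : Subgroup G}

/-- The isomorphisms of a category on `P`. -/
def CategoryOn.isos (F : CategoryOn P) : IsoFamily G := fun Q R => {e | e.toMonoidHom ∈ F.Hom Q R}

namespace CategoryOn

variable {F : CategoryOn P}

theorem symm_mem_isos {e : Q ≃* R} (he : e ∈ F.isos Q R) : e.symm ∈ F.isos R Q :=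
  (F.iso_mem he R e fun _ => rfl).2

theorem isIso_of_mem_isos {e : Q ≃* R} (he : e ∈ F.isos Q R) : F.IsIso e :=
  ⟨he, symm_mem_isos he⟩

theorem trans_mem_isos {e : Q ≃* R} {f : R ≃* S} (he : e ∈ F.isos Q R) (hf : f ∈ F.isos R S) :
    e.trans f ∈ F.isos Q S := F.comp_mem he hf

theorem exists_iso_of_mem {φ : Q →* R} (hφ : φ ∈ F.Hom Q R) :
    ∃ (T : Subgroup G) (e : Q ≃* T), e ∈ F.isos Q T ∧ T ≤ R ∧ ∀ x : Q, app e x = φ x := by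
  obtain ⟨T, e, he⟩ := exists_iso_of_hom Q (R.subtype.comp φ)
    ((Subgroup.subtype_injective _).comp (F.injective hφ))
  have h : ∀ x : Q, app e x = φ x := fun x => he x x.2
  exact ⟨T, e, (F.iso_mem hφ T e fun x => by rw [← h x, app_coe]).1,
    le_of_iso e fun x => by rw [← h x, app_coe], h⟩

theorem res_mem_isos {A B : Subgroup G} {e : Q ≃* R} {f : A ≃* B}
    (hinc : ∀ (h : A ≤ Q), Q ≤ P → Subgroup.inclusion h ∈ F.Hom A Q) (he : e ∈ F.isos Q R)
    (h : IsRes f e) : f ∈ F.isos A B := by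
  refine (F.iso_mem (F.comp_mem (hinc h.1 (F.le_of_mem he).1) he) B f fun x => ?_).1
  rw [← app_coe, h.2 x x.2, app_of_mem e (h.1 x.2)]
  rfl

/-- The normalizer and centralizer categories ask for an extension to the join with `A`. When `A`
lies in domain and codomain the map is its own extension, after rewriting the joins. -/
theorem exists_hom_sup {A : Subgroup G} {e : Q ≃* R} (he : e ∈ F.isos Q R) (hQ : A ≤ Q)
    (hR : A ≤ R) : ∃ ψ ∈ F.Hom (A ⊔ Q) (A ⊔ R), ∀ x : ↥(A ⊔ Q), (ψ x : G) = app e x := by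
  have h : ∀ Q' R' : Subgroup G, Q' = Q → R' = R →
      ∃ ψ ∈ F.Hom Q' R', ∀ x : Q', (ψ x : G) = app e x := by
    rintro Q' R' rfl rfl
    exact ⟨e.toMonoidHom, he, fun x => (app_coe e x).symm⟩
  exact h _ _ (sup_eq_right.2 hQ) (sup_eq_right.2 hR)

theorem exists_fullyNormalized [Finite P] (hQ : MulEquiv.refl Q ∈ F.isos Q Q) :
    ∃ (R : Subgroup G) (e : Q ≃* R), e ∈ F.isos Q R ∧ F.FullyNormalized R := by
  have hfin : ((fun R : Subgroup G => Nat.card (normalizerIn P R)) ''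
      {R : Subgroup G | ∃ e : Q ≃* R, e ∈ F.isos Q R}).Finite := by
    refine (Set.finite_Iic (Nat.card P)).subset ?_
    rintro _ ⟨A, -, rfl⟩
    exact Subgroup.card_le_of_le inf_le_left
  obtain ⟨_, ⟨R, ⟨e, he⟩, rfl⟩, hmax⟩ := hfin.exists_maximal ⟨_, Q, ⟨_, hQ⟩, rfl⟩
  refine ⟨R, e, he, (F.le_of_mem he).2, fun R' f hf => ?_⟩
  by_contra hlt
  exact hlt (hmax ⟨R', ⟨_, trans_mem_isos he hf.1⟩, rfl⟩ (not_le.1 hlt).le)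

namespace IsSaturated

theorem inclusion_mem (hF : F.IsSaturated p) (h : Q ≤ R) (hR : R ≤ P) :
    Subgroup.inclusion h ∈ F.Hom Q R :=
  hF.conj_mem (h.trans hR) hR _ 1 (one_mem _) fun x => by simp

theorem res_mem (hF : F.IsSaturated p) {A B : Subgroup G} {e : Q ≃* R} {f : A ≃* B}
    (he : e ∈ F.isos Q R) (h : IsRes f e) : f ∈ F.isos A B :=
  res_mem_isos (fun h hQ => hF.inclusion_mem h hQ) he h

theorem conj_mem_isos (hF : F.IsSaturated p) {e : Q ≃* R} {n : G} (hn : n ∈ P) (hQ : Q ≤ P)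
    (h : ∀ x ∈ Q, app e x = n * x * n⁻¹) : e ∈ F.isos Q R :=
  hF.conj_mem hQ (cod_le_of_app e fun x hx => by
    rw [h x hx]; exact mul_mem (mul_mem hn (hQ hx)) (inv_mem hn)) _ n hn
    fun x => by rw [← h x x.2, app_coe]; rfl

theorem exists_extension_of_fullyNormalized (hF : F.IsSaturated p) [Finite P]
    (hR : F.FullyNormalized R) {e : Q ≃* R}
    (he : e ∈ F.isos Q R) {T : Subgroup G} (hT : T ≤ P) (hQT : Q ≤ T)
    (hnorm : ∀ x ∈ T, ∀ z ∈ Q, x * z * x⁻¹ ∈ Q)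
    (h : ∀ x ∈ T, ∃ y ∈ P, ∀ z ∈ Q, app e (x * z * x⁻¹) = y * app e z * y⁻¹) :
    ∃ (T' : Subgroup G) (f : T ≃* T'), f ∈ F.isos T T' ∧ IsRes e f := by
  have : Finite Q := finite_of_le (hQT.trans hT)
  have : Finite R := finite_of_le hR.1
  obtain ⟨ψ, hψ, hext⟩ := hF.extension e (isIso_of_mem_isos he) hR
  have himg : image e.toMonoidHom Q = R := by
    ext t
    rw [mem_image]
    constructor
    · rintro ⟨x, -, rfl⟩
      exact (e x).2
    · intro ht
      exact ⟨e.symm ⟨t, ht⟩, (e.symm ⟨t, ht⟩).2,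
        congrArg Subtype.val (e.apply_symm_apply ⟨t, ht⟩)⟩
  have hle : T ≤ extensionGroup P e.toMonoidHom := by
    intro x hx
    obtain ⟨y, hy, hyz⟩ := h x hx
    refine ⟨mem_normalizerIn_iff.2 ⟨hT hx, hnorm x hx⟩, y, ?_, fun z w hw => ?_⟩
    · rw [himg]
      refine mem_normalizerIn_iff.2 ⟨hy, fun r hr => ?_⟩
      have h1 := app_mem e.symm hr
      rw [← app_app_symm e hr, ← hyz _ h1]
      exact app_mem e (hnorm x hx _ h1)
    · have h1 := hyz z z.2
      rw [← hw, app_coe, app_coe] at h1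
      exact h1
  obtain ⟨T', f, hf, -, hfx⟩ := exists_iso_of_mem
    (F.comp_mem (hF.inclusion_mem hle (F.le_of_mem hψ).1) hψ)
  refine ⟨T', f, hf, hQT, fun x hx => ?_⟩
  have h1 := hfx ⟨x, hQT hx⟩
  rw [show app f x = _ from h1, app_of_mem e hx]
  exact (hext.2 ⟨x, hx⟩ ⟨x, hle (hQT hx)⟩ rfl).symm

theorem full_top (hF : F.IsSaturated p) [Fact p.Prime] [Finite P]
    (T : Subgroup (MulAut P)) (hT : IsPGroup p T)
    (hTF : ∀ α ∈ T, α ∈ F.isos P P) :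
    ∃ β : MulAut P, β ∈ F.isos P P ∧ ConjInto β T (conjAut P P) := by
  obtain ⟨S, hS⟩ := hF.sylow
  have hT' : IsPGroup p (T.subgroupOf (F.aut P le_rfl)) := hT.comap_subtype
  obtain ⟨S', hS'⟩ := hT'.exists_le_sylow
  obtain ⟨β, hβ⟩ := MulAction.exists_smul_eq (F.aut P le_rfl) S' S
  refine ⟨β, β.2.1, fun t ht => ?_⟩
  have htA : t ∈ F.aut P le_rfl := isIso_of_mem_isos (hTF t ht)
  have h1 : (⟨t, htA⟩ : F.aut P le_rfl) ∈ S' := hS' (Subgroup.mem_subgroupOf.2 ht)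
  have h2 : β * ⟨t, htA⟩ * β⁻¹ ∈ (S : Subgroup (F.aut P le_rfl)) := by
    rw [← hβ]
    exact Subgroup.smul_mem_pointwise_smul _ (MulAut.conj β) _ h1
  have h3 : (β : MulAut P) * t * (β : MulAut P)⁻¹ ∈ (MulAut.conj : P →* MulAut P).range := by
    rw [← hS]
    exact ⟨_, h2, rfl⟩
  obtain ⟨n, hn⟩ := h3
  refine ⟨n, n.2, fun x hx => ?_⟩
  rw [← hn, app_of_mem _ hx]
  rfl

/-- Fully normalized subgroups are fully automized. -/
theorem full_of_fullyNormalized (hF : F.IsSaturated p) [Fact p.Prime] [Finite P]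
    (hP : IsPGroup p P) (m : ℕ) :
    ∀ R : Subgroup G, F.FullyNormalized R → Nat.card P < m + Nat.card R →
      ∀ T : Subgroup (MulAut R), IsPGroup p T → (∀ α ∈ T, α ∈ F.isos R R) →
        ∃ β : MulAut R, β ∈ F.isos R R ∧ ConjInto β T (conjAut P R) := by
  induction m with
  | zero =>
    intro R hR hc
    have := Subgroup.card_le_of_le hR.1
    omega
  | succ m ih =>
    intro R hR hc
    by_cases hRP : R = P
    · subst hRP
      exact hF.full_top
    have : Finite R := finite_of_le hR.1
    have hRlt : R < P := lt_of_le_of_ne hR.1 hRP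
    let A : Subgroup (MulAut R) :=
      { carrier := {α | α ∈ F.isos R R}
        one_mem' := F.id_mem hR.1
        mul_mem' := fun ha hb => trans_mem_isos hb ha
        inv_mem' := fun ha => symm_mem_isos ha }
    have hSA : conjAut P R ≤ A := fun α ⟨n, hn, h⟩ => hF.conj_mem_isos hn hR.1 h
    have hSp := isPGroup_conjAut hP R
    obtain ⟨S₁, hS₁A, hS₁, hle, hS₁full⟩ := exists_sylow_of_le hSp hSA
    -- It is enough that `conjAut P R` is a Sylow subgroup of Aut_F(R). If not, some `φ` in `S₁`
    -- outside it normalizes it, and therefore extends to `N_P(R)`.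
    suffices heq : conjAut P R = S₁ by
      rw [heq]
      exact fun T hT hTA => hS₁full T hT hTA
    by_contra hne
    obtain ⟨φ, hφS₁, hφ, hφn⟩ := exists_normalizing hS₁ (lt_of_le_of_ne hle hne)
    have hφF : φ ∈ F.isos R R := hS₁A hφS₁
    set N := normalizerIn P R with hN
    have hNP : N ≤ P := inf_le_left
    have : Finite N := finite_of_le hNP
    have hRN : R ≤ N := le_normalizerIn_self hR.1
    have hNR : ∀ x ∈ N, ∀ z ∈ R, x * z * x⁻¹ ∈ R := fun x hx => (mem_normalizerIn_iff.1 hx).2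
    obtain ⟨T, ψ₀, hψ₀, hres₀⟩ := hF.exists_extension_of_fullyNormalized hR hφF hNP hRN hNR (by
      intro x hx
      obtain ⟨γ, hγ⟩ := exists_conj_eq (hNR x hx)
      obtain ⟨y, hy, h⟩ := hφn γ ⟨x, hNP hx, hγ⟩
      refine ⟨y, hy, fun z hz => ?_⟩
      have h1 := h _ (app_mem φ hz)
      rwa [app_mul_aut _ _ (app_mem _ hz), app_inv_aut_app _ hz, app_mul_aut _ _ hz,
        hγ z hz] at h1)
    have hTN : T = N := by
      refine cod_eq_of_app ψ₀ (fun x hx => mem_normalizerIn_iff.2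
        ⟨(F.le_of_mem hψ₀).2 (app_mem ψ₀ hx), fun r hr => ?_⟩) le_rfl
      have h1 := app_mem φ⁻¹ hr
      have h2 : app φ (app φ⁻¹ r) = r := app_app_inv_aut φ hr
      rw [hres₀.2 _ h1] at h2
      rw [← h2, ← app_conj ψ₀ hx (hRN h1), ← hres₀.2 _ (hNR x hx _ h1)]
      exact app_mem φ (hNR x hx _ h1)
    subst hTN
    obtain ⟨ψ, rfl⟩ : ∃ ψ : MulAut N, ψ = ψ₀ := ⟨ψ₀, rfl⟩
    have hrespow : ∀ (k : ℕ), ∀ x ∈ R, app (φ ^ k) x = app (ψ ^ k) x := by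
      intro k
      induction k with
      | zero => intro x hx; rw [pow_zero, pow_zero, app_one_aut hx, app_one_aut (hRN hx)]
      | succ k ihk =>
        intro x hx
        rw [pow_succ', pow_succ', app_mul_aut _ _ hx, app_mul_aut _ _ (hRN hx), ← ihk x hx]
        exact hres₀.2 _ (app_mem _ hx)
    -- Raising to the `p'`-part `m'` of the order of `ψ` makes `ψ` a `p`-element. It does not put
    -- `φ` into `conjAut P R`, since `φ` has `p`-power order and is a power of `φ ^ m'`.
    obtain ⟨a, m', hm', hord⟩ := Nat.exists_eq_pow_mul_and_not_dvd (orderOf_pos ψ).ne' p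
      (Fact.out : p.Prime).ne_one
    have hφ' : φ ^ m' ∉ conjAut P R := by
      intro hmem
      obtain ⟨k, hk⟩ := hS₁ ⟨φ, hφS₁⟩
      have hk' : φ ^ p ^ k = 1 := congrArg Subtype.val hk
      have hcop : m'.Coprime (orderOf φ) := by
        refine Nat.Coprime.coprime_dvd_right (orderOf_dvd_of_pow_eq_one hk') ?_
        exact Nat.Coprime.pow_right k (((Nat.Prime.coprime_iff_not_dvd Fact.out).2 hm').symm)
      obtain ⟨i, hi⟩ := exists_pow_eq_self_of_coprime hcop
      exact hφ (hi ▸ pow_mem hmem i)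
    have hψF : ψ ^ m' ∈ F.isos N N := by
      have : ∀ k : ℕ, ψ ^ k ∈ F.isos N N := by
        intro k
        induction k with
        | zero => exact F.id_mem hNP
        | succ k ihk => rw [pow_succ']; exact trans_mem_isos ihk hψ₀
      exact this m'
    have hψp : (ψ ^ m') ^ p ^ a = 1 := by
      rw [← pow_mul, mul_comm, ← hord, pow_orderOf_eq_one]
    have hzp : IsPGroup p (Subgroup.zpowers (ψ ^ m')) := by
      rintro ⟨_, i, rfl⟩
      refine ⟨a, Subtype.ext ?_⟩
      change ((ψ ^ m') ^ i) ^ p ^ a = 1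
      rw [← zpow_natCast, zpow_comm, zpow_natCast, hψp, one_zpow]
    obtain ⟨N', τ₀, hτ₀, hN'⟩ := exists_fullyNormalized (F := F) (Q := N) (F.id_mem hNP)
    have hcT : Nat.card R < Nat.card N := by
      obtain ⟨k, hk, hkR, hnorm⟩ := exists_normalizing hP hRlt
      refine card_lt_of_lt (lt_of_le_of_ne hRN fun heq => hkR ?_)
      rw [heq, hN]
      exact mem_normalizerIn_iff.2 ⟨hk, hnorm⟩
    -- `N'` is larger than `R`, so by induction `ψ ^ m'`, carried to `N'` by a suitable `τ`, is
    -- conjugation by some `y` in `P`.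
    obtain ⟨β, hβ, hβc⟩ := ih N' hN' (by rw [← card_eq_of_iso τ₀]; omega)
      ((Subgroup.zpowers (ψ ^ m')).map (MulAut.congr τ₀).toMonoidHom) (hzp.map _) (by
        have h1 : Subgroup.zpowers (ψ ^ m') ≤
            { carrier := {α : MulAut N | α ∈ F.isos N N}
              one_mem' := F.id_mem hNP
              mul_mem' := fun ha hb => trans_mem_isos hb ha
              inv_mem' := fun ha => symm_mem_isos ha : Subgroup (MulAut N) } := by
          rw [Subgroup.zpowers_le]; exact hψF
        rintro _ ⟨α, hα, rfl⟩
        exact trans_mem_isos (symm_mem_isos hτ₀) (trans_mem_isos (h1 hα) hτ₀))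
    obtain ⟨τ, hτ, y, hy, hτy⟩ : ∃ τ : N ≃* N', τ ∈ F.isos N N' ∧ ∃ y ∈ P, ∀ x ∈ N',
        app (MulAut.congr τ (ψ ^ m')) x = y * x * y⁻¹ :=
      ⟨τ₀.trans β, trans_mem_isos hτ₀ hβ, hβc _ ⟨_, Subgroup.mem_zpowers _, rfl⟩⟩
    have hτψ : ∀ z ∈ N, app τ (app (ψ ^ m') z) = y * app τ z * y⁻¹ := fun z hz => by
      rw [← hτy _ (app_mem τ hz), app_congr _ _ (app_mem τ hz), app_symm_app τ hz]
    obtain ⟨R₁, f, hf⟩ := exists_res τ hRN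
    have hfF := hF.res_mem hτ hf
    have hR₁P := (F.le_of_mem hfF).2
    have : Finite R₁ := finite_of_le hR₁P
    have hN'R₁ : N' ≤ normalizerIn P R₁ := by
      refine le_normalizerIn_of hN'.1 fun t ht r hr => ?_
      have h1 := app_mem τ.symm ht
      have h2 := app_mem f.symm hr
      rw [← app_app_symm τ ht, ← app_app_symm f hr, hf.2 _ h2, ← app_conj τ h1 (hRN h2),
        ← hf.2 _ (hNR _ h1 _ h2)]
      exact app_mem f (hNR _ h1 _ h2)
    have : Finite (normalizerIn P R₁) := finite_of_le inf_le_left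
    -- Full normalization of `R` bounds `|N_P(R₁)|` by `|N_P(R)| = |N'|`. As `y` normalizes `R₁`, it
    -- lies in `N'`, and its preimage under `τ` induces `φ ^ m'` on `R`, a contradiction.
    have hN'eq : N' = normalizerIn P R₁ := by
      refine eq_of_le_of_card hN'R₁ ?_
      rw [← card_eq_of_iso τ]
      exact hR.2 R₁ f (isIso_of_mem_isos hfF)
    have hyN' : y ∈ N' := by
      rw [hN'eq]
      refine mem_normalizerIn_iff.2 ⟨hy, fun r hr => ?_⟩
      have h2 := app_mem f.symm hr
      have h3 := app_mem (φ ^ m') h2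
      rw [← app_app_symm f hr, hf.2 _ h2, ← hτψ _ (hRN h2), ← hrespow m' _ h2, ← hf.2 _ h3]
      exact app_mem f h3
    have hx := app_mem τ.symm hyN'
    refine hφ' ⟨app τ.symm y, hNP hx, fun z hz => ?_⟩
    have hz' := hRN hz
    rw [hrespow m' z hz]
    refine app_inj τ (app_mem _ hz') (mul_mem (mul_mem hx hz') (inv_mem hx)) ?_
    rw [hτψ z hz', app_conj τ hx hz', app_app_symm τ hyN']

/-- The isomorphisms of a saturated fusion system form a saturated system. -/
theorem isLocalSystem (hF : F.IsSaturated p) [Fact p.Prime] [Finite P] (hP : IsPGroup p P) :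
    IsLocalSystem p ⊥ P F.isos where
  finite := inferInstance
  isPGroup := hP
  le := bot_le
  norm := fun n _ x hx => by rw [Subgroup.mem_bot] at hx ⊢; rw [hx]; group
  dom := fun he => ⟨bot_le, (F.le_of_mem he).1⟩
  symm := symm_mem_isos
  trans := trans_mem_isos
  res := fun he h _ => hF.res_mem he h
  pres := fun {Q R e} _ x hx => by rw [Subgroup.mem_bot] at hx ⊢; rw [hx, app_one]
  conj := fun hn _ hQ h => hF.conj_mem_isos hn hQ h
  nice := fun {Q} _ hQ => by
    obtain ⟨R, e, he, hR⟩ := exists_fullyNormalized (F := F) (Q := Q) (F.id_mem hQ)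
    exact ⟨R, e, he, hF.full_of_fullyNormalized hP (Nat.card P + 1) R hR (by omega),
      fun he _ hT hQT hn h => hF.exists_extension_of_fullyNormalized hR he hT hQT hn h⟩

end IsSaturated

end CategoryOn

end Saturated

/-! ### The two generating subcategories -/

section Generation

variable {G : Type*} [Group G] {p : ℕ} {P Q R : Subgroup G} {F : CategoryOn P}

theorem mem_centerOf {x : G} : x ∈ centerOf P ↔ x ∈ P ∧ ∀ g ∈ P, g * x = x * g := by
  constructor
  · rintro ⟨z, hz, rfl⟩
    exact ⟨z.2, fun g hg => congrArg Subtype.val (Subgroup.mem_center_iff.1 hz ⟨g, hg⟩)⟩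
  · rintro ⟨hx, h⟩
    exact ⟨⟨x, hx⟩, Subgroup.mem_center_iff.2 fun g => Subtype.ext (h g g.2), rfl⟩

theorem mho_le (n : ℕ) : mho p n Q ≤ Q := by
  rw [mho, Subgroup.closure_le]
  rintro _ ⟨x, hx, rfl⟩
  exact pow_mem hx _

namespace CategoryOn

theorem IsSaturated.inclusion_mem_normalizer [Finite P] (hF : F.IsSaturated p) (h : Q ≤ R) (hR : R ≤ P) :
    Subgroup.inclusion h ∈ (F.normalizer (thompson P) (thompson_le P)).Hom Q R := by
  have : Finite (thompson P) := finite_of_le (thompson_le P)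
  have hle : P ≤ normalizerIn P (thompson P) := le_normalizerIn_of le_rfl fun t ht =>
    conj_mem_thompson fun x hx => mul_mem (mul_mem ht hx) (inv_mem ht)
  refine ⟨(h.trans hR).trans hle, hR.trans hle, hF.inclusion_mem h hR, _,
    hF.inclusion_mem (sup_le_sup_left h _) (sup_le (thompson_le P) hR),
    ⟨le_sup_right, fun x y hxy => hxy⟩, image_eq_of_id le_sup_left fun _ _ => rfl⟩

theorem mem_centralizer_of_app_pow {e : Q ≃* R} (he : e ∈ F.isos Q R)
    (hQ : centerOf P ≤ Q) (hfix : ∀ z ∈ centerOf P, app e (z ^ p) = z ^ p) :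
    e.toMonoidHom ∈ (F.centralizer (mho p 1 (centerOf P)) (mho_centerOf_le p 1 P)).Hom Q R := by
  have hle := F.le_of_mem he
  have hWQ : mho p 1 (centerOf P) ≤ Q := (mho_le 1).trans hQ
  have hfix' : ∀ w ∈ mho p 1 (centerOf P), app e w = w := by
    have h : mho p 1 (centerOf P) ≤ fixedBy e := by
      rw [mho, Subgroup.closure_le]
      rintro _ ⟨z, hz, rfl⟩
      rw [pow_one]
      exact ⟨pow_mem (hQ hz) p, hfix z hz⟩
    exact fun w hw => (h hw).2
  have hWR : mho p 1 (centerOf P) ≤ R := fun w hw => by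
    rw [← hfix' w hw]; exact app_mem e (hWQ hw)
  have hcent : P ≤ centralizerIn P (mho p 1 (centerOf P)) := fun x hx =>
    ⟨hx, Subgroup.mem_centralizer_iff.2 fun w hw =>
      ((mem_centerOf.1 (mho_le 1 hw)).2 x hx).symm⟩
  obtain ⟨ψ, hψ, h⟩ := exists_hom_sup he hWQ hWR
  refine ⟨hle.1.trans hcent, hle.2.trans hcent, he, ψ, hψ, ⟨le_sup_right, fun x y hxy => ?_⟩,
    fun x hx => by rw [h, hfix' _ hx]⟩
  rw [h, hxy, app_coe]
  rfl

theorem mem_normalizer_of_thompson_le [Finite P] {e : Q ≃* R} (he : e ∈ F.isos Q R)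
    (hQ : thompson P ≤ Q) :
    e.toMonoidHom ∈ (F.normalizer (thompson P) (thompson_le P)).Hom Q R := by
  have : Finite (thompson P) := finite_of_le (thompson_le P)
  have hle := F.le_of_mem he
  have hJ := app_mem_thompson e hQ hle.2
  have hnorm : P ≤ normalizerIn P (thompson P) := le_normalizerIn_of le_rfl fun t ht =>
    conj_mem_thompson fun x hx => mul_mem (mul_mem ht hx) (inv_mem ht)
  obtain ⟨ψ, hψ, h⟩ := exists_hom_sup he hQ (le_cod_of_app e hQ hJ)
  refine ⟨hle.1.trans hnorm, hle.2.trans hnorm, he, ψ, hψ, ⟨le_sup_right, fun x y hxy => ?_⟩, ?_⟩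
  · rw [h, hxy, app_coe]
    rfl
  · ext t
    rw [mem_image]
    constructor
    · rintro ⟨x, hx, rfl⟩
      rw [h]
      exact hJ x hx
    · intro ht
      have h1 := app_symm_mem_self e hQ hJ t ht
      refine ⟨⟨_, le_sup_left (b := Q) h1⟩, h1, ?_⟩
      rw [h]
      exact app_app_symm e (le_cod_of_app e hQ hJ ht)

end CategoryOn

end Generation
end FusionSystem

theorem mainTheorem3 {G : Type*} [Group G] (p : ℕ) [Fact p.Prime]
    (P : Subgroup G) [Finite P] (hP : IsPGroup p P)
    (F : CategoryOn P) (hF : F.IsSaturated p) :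
    F = generated P (fun Q R =>
      (F.centralizer (mho p 1 (centerOf P)) (mho_centerOf_le p 1 P)).Hom Q R ∪
      (F.normalizer (thompson P) (thompson_le P)).Hom Q R) := by
  ext Q R φ
  constructor
  · intro hφ
    refine ⟨(F.le_of_mem hφ).1, (F.le_of_mem hφ).2, F.injective hφ, fun C hC => ?_⟩
    -- A category on `P` need not contain the inclusions. Those of `N_F(J(P))`, which is a category
    -- on all of `P`, make the isomorphisms of `C` closed under restriction.
    have hinc : ∀ {A B : Subgroup G} (h : A ≤ B), B ≤ P → Subgroup.inclusion h ∈ C.Hom A B :=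
      fun h hB => hC _ _ (Or.inr (hF.inclusion_mem_normalizer h hB))
    have hclosed : IsClosedFamily C.isos :=
      ⟨CategoryOn.symm_mem_isos, CategoryOn.trans_mem_isos,
        fun he h => CategoryOn.res_mem_isos (fun h hQ => hinc h hQ) he h⟩
    obtain ⟨T, e, he, hT, heφ⟩ := CategoryOn.exists_iso_of_mem hφ
    -- The local system of `F` has `X = ⊥`, so `|P|` bounds the induction parameter.
    have heC : e ∈ C.isos Q T := by
      refine (hF.isLocalSystem hP).subset_of_generators (Nat.card P) (Nat.le_add_right _ _) hclosed
        (Z := centerOf P) (fun x hx => (mem_centerOf.1 hx).1)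
        (fun n hn z hz => (mem_centerOf.1 hz).2 n hn) (fun he hZ hz => ?_) (fun he hJ => ?_) he
      · exact hC _ _ (Or.inl (CategoryOn.mem_centralizer_of_app_pow he hZ hz))
      · exact hC _ _ (Or.inr (CategoryOn.mem_normalizer_of_thompson_le he hJ))
    have h := C.comp_mem heC (hinc hT (F.le_of_mem hφ).2)
    convert h using 1
    ext x
    rw [← heφ x, app_coe]
    rfl
  · rintro ⟨-, -, -, h⟩
    refine h F fun S T ψ hψ => ?_
    rcases hψ with hψ | hψ
    · exact hψ.2.2.1
    · exact hψ.2.2.1
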